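/- Let $p$ be a prime, $q = p^r$ with $r \ge 1$, $n$ a non-negative integer, $l$ a prime with $l \neq 2, p$, and $k$ a field with $\operatorname{char} k \neq l$. For $a \in \mathbb{F}_{q^2}$ write $\overline{a} = a^q$, and apply this entrywise to matrices. Let $\beta$ be an invertible $n \times n$ matrix over $\mathbb{F}_{q^2}$ that is Hermitian, i.e. $\beta^T = \overline{\beta}$, and put $$SU(n,q^2) = \{M \in GL_n(\mathbb{F}_{q^2}) : M^T \beta \overline{M} = \beta,\ \det M = 1\}, \qquad PSU(n,q^2) = SU(n,q^2)/Z(SU(n,q^2)).$$ For a finite group $G$, a field extension $F/k$ and a $G$-torsor $T$ over $\operatorname{Spec} F$ (equivalently, a Galois $G$-algebra over $F$), let $\operatorname{ed}_k(T)$ be the minimum of $\operatorname{trdeg}_k(E)$ over the fields $k \subseteq E \subseteq F$ such that $T$ is isomorphic to the base change to $F$ of a $G$-torsor over $\operatorname{Spec} E$, and let $\operatorname{ed}_k(T,l)$ be the minimum of $\operatorname{ed}_k(T_{F'})$ over the finite extensions $F'/F$ with $l \nmid [F':F]$. The essential $l$-dimension $\operatorname{ed}_k(G,l)$ is the supremum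 of $\operatorname{ed}_k(T,l)$ over all field extensions $F/k$ and all $G$-torsors $T$ over $\operatorname{Spec} F$. Then $$\operatorname{ed}_k(PSU(n,q^2),l) = \begin{cases} \operatorname{ed}_k(SU(n,q^2),l), & l \nmid n \text{ or } l \nmid q+1,\\ \operatorname{ed}_k(PSL_n(\mathbb{F}_{q^2}),l), & l \mid n \text{ and } l \mid q+1. \end{cases}$$ Moreover, if $l \mid n$ and $l \mid q+1$, then the Sylow $l$-subgroups of $PSU(n,q^2)$ are isomorphic to the Sylow $l$-subgroups of $PSL_n(\mathbb{F}_{q^2})$. -/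

import Mathlib

open scoped TensorProduct

universe u v

noncomputable section

/-! ### Torsors under a finite group, and essential dimension at a prime -/

/-- A commutative `F`-algebra with a left action of `G` by `F`-algebra automorphisms, i.e. an
affine `F`-scheme with a right `G`-action. -/
structure GAlgebra (G : Type v) [Group G] (F : Type u) [Field F] where
  carrier : Type u
  [commRing : CommRing carrier]
  [algebra : Algebra F carrier]
  act : G →* (carrier ≃ₐ[F] carrier)

namespace GAlgebra

attribute [instance] GAlgebra.commRing GAlgebra.algebra

variable {G : Type v} [Group G] {F : Type u} [Field F]

/-- The map `A ⊗ A → ∏_{g ∈ G} A`, `a ⊗ b ↦ (a * g b)_g`; on spectra it is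
`X × G → X × X`, `(x, g) ↦ (x, x g)`. -/
def torsorMap (A : GAlgebra G F) : A.carrier ⊗[F] A.carrier →ₐ[F] (G → A.carrier) :=
  AlgHom.pi fun g =>
    Algebra.TensorProduct.productMap (AlgHom.id F A.carrier) (A.act g).toAlgHom

/-- `A` is a Galois `G`-algebra over `F`; equivalently `Spec A` is a `G`-torsor over `Spec F`. -/
structure IsTorsor (A : GAlgebra G F) : Prop where
  nontrivial : Nontrivial A.carrier
  finite : Module.Finite F A.carrier
  bijective : Function.Bijective A.torsorMap

/-- Two `G`-algebras over `F` are isomorphic, by a `G`-equivariant `F`-algebra isomorphism. -/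
def Iso (A B : GAlgebra G F) : Prop :=
  ∃ e : A.carrier ≃ₐ[F] B.carrier, ∀ (g : G) (a : A.carrier), e (A.act g a) = B.act g (e a)

/-- Extension of scalars of a `G`-algebra along `F → K`; `G` acts through the second factor. -/
def baseChange (A : GAlgebra G F) (K : Type u) [Field K] [Algebra F K] : GAlgebra G K where
  carrier := K ⊗[F] A.carrier
  act :=
    { toFun := fun g => Algebra.TensorProduct.congr AlgEquiv.refl (A.act g)
      map_one' := by
        ext x
        induction x using TensorProduct.induction_on with
        | zero => simp
        | tmul a b => simp
        | add a b ha hb => simp only [map_add, ha, hb]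
      map_mul' := by
        intro g h
        ext x
        induction x using TensorProduct.induction_on with
        | zero => simp
        | tmul a b => simp
        | add a b ha hb => simp only [map_add, ha, hb] }

/-- The essential dimension of (the class of) a `G`-torsor `A` over an extension `F` of `k`: the
least transcendence degree over `k` of an intermediate field `k ⊆ E ⊆ F` such that `A` is
isomorphic to the base change of a `G`-torsor over `E`. -/
def essDim (k : Type u) [Field k] [Algebra k F] (A : GAlgebra G F) : ℕ∞ :=
  ⨅ (E : IntermediateField k F) (B : GAlgebra G E) (_ : B.IsTorsor)
    (_ : (B.baseChange F).Iso A), Cardinal.toENat (Algebra.trdeg k E)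

/-- The essential `l`-dimension of (the class of) a `G`-torsor `A` over an extension `F` of `k`:
the least essential dimension of `A` after a finite extension `F'/F` of degree prime to `l`. -/
def essDimAt (k : Type u) [Field k] [Algebra k F] (A : GAlgebra G F) (l : ℕ) : ℕ∞ :=
  ⨅ (F' : Type u) (_ : Field F') (_ : Algebra k F') (_ : Algebra F F')
    (_ : IsScalarTower k F F') (_ : FiniteDimensional F F')
    (_ : ¬ l ∣ Module.finrank F F'), (A.baseChange F').essDim k

end GAlgebra

/-- The essential `l`-dimension `ed_k(G, l)` of a finite group `G`: the supremum of the essential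
`l`-dimensions of all `G`-torsors over all field extensions of `k`. -/
def essentialDimensionAt (k : Type u) [Field k] (G : Type v) [Group G] (l : ℕ) : ℕ∞ :=
  ⨆ (F : Type u) (_ : Field F) (_ : Algebra k F) (A : GAlgebra G F) (_ : A.IsTorsor),
    A.essDimAt k l

/-! ### Unitary groups over finite fields -/

/-- The unitary group `{M ∈ GL_n(K) : Mᵀ β M̄ = β}`, where the bar is the entrywise
application of `σ`. -/
def unitaryGroupOf {K : Type u} [Field K] (σ : K →+* K) {n : ℕ} (β : Matrix (Fin n) (Fin n) K) :
    Subgroup (GL (Fin n) K) where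
  carrier := {M | (M : Matrix (Fin n) (Fin n) K).transpose * β *
    (M : Matrix (Fin n) (Fin n) K).map σ = β}
  one_mem' := by simp
  mul_mem' := by
    intro M N hM hN
    simp only [Set.mem_ofPred_eq] at hM hN ⊢
    rw [Units.val_mul, Matrix.transpose_mul, Matrix.map_mul]
    calc _ = (N : Matrix (Fin n) (Fin n) K).transpose *
          ((M : Matrix (Fin n) (Fin n) K).transpose * β *
            (M : Matrix (Fin n) (Fin n) K).map σ) * (N : Matrix (Fin n) (Fin n) K).map σ := by
            simp only [Matrix.mul_assoc]
      _ = β := by rw [hM, hN]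
  inv_mem' := by
    intro M hM
    simp only [Set.mem_ofPred_eq] at hM ⊢
    have h1 : ((M⁻¹ : GL (Fin n) K) : Matrix (Fin n) (Fin n) K).transpose *
        (M : Matrix (Fin n) (Fin n) K).transpose = 1 := by
      rw [← Matrix.transpose_mul, ← Units.val_mul]; simp
    have h2 : (M : Matrix (Fin n) (Fin n) K).map σ *
        ((M⁻¹ : GL (Fin n) K) : Matrix (Fin n) (Fin n) K).map σ = 1 := by
      rw [← Matrix.map_mul, ← Units.val_mul]; simp
    calc _ = ((M⁻¹ : GL (Fin n) K) : Matrix (Fin n) (Fin n) K).transpose *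
          ((M : Matrix (Fin n) (Fin n) K).transpose * β * (M : Matrix (Fin n) (Fin n) K).map σ) *
            ((M⁻¹ : GL (Fin n) K) : Matrix (Fin n) (Fin n) K).map σ := by rw [hM]
      _ = (((M⁻¹ : GL (Fin n) K) : Matrix (Fin n) (Fin n) K).transpose *
          (M : Matrix (Fin n) (Fin n) K).transpose) * β * ((M : Matrix (Fin n) (Fin n) K).map σ *
            ((M⁻¹ : GL (Fin n) K) : Matrix (Fin n) (Fin n) K).map σ) := by
            simp only [Matrix.mul_assoc]
      _ = β := by rw [h1, h2, Matrix.one_mul, Matrix.mul_one]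

/-- The special unitary group: the elements of determinant one of the unitary group. -/
def specialUnitaryGroupOf {K : Type u} [Field K] (σ : K →+* K) {n : ℕ}
    (β : Matrix (Fin n) (Fin n) K) : Subgroup (GL (Fin n) K) :=
  unitaryGroupOf σ β ⊓ (Matrix.GeneralLinearGroup.det : GL (Fin n) K →* Kˣ).ker

/-- The conjugation `a ↦ ā = a ^ q` of the field with `q ^ 2` elements, where `q = p ^ r`: the
nontrivial automorphism over the subfield with `q` elements. -/
def conjFq (p : ℕ) [Fact p.Prime] (r : ℕ) : GaloisField p (2 * r) →+* GaloisField p (2 * r) :=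
  iterateFrobenius (GaloisField p (2 * r)) p r

/-- `SU(n, q ^ 2)` with respect to the Hermitian matrix `β`, where `q = p ^ r`. -/
abbrev SU (p : ℕ) [Fact p.Prime] (r n : ℕ) (β : Matrix (Fin n) (Fin n) (GaloisField p (2 * r))) :
    Type :=
  specialUnitaryGroupOf (conjFq p r) β

/-- `PSU(n, q ^ 2)`: the quotient of `SU(n, q ^ 2)` by its center. -/
abbrev PSU (p : ℕ) [Fact p.Prime] (r n : ℕ) (β : Matrix (Fin n) (Fin n) (GaloisField p (2 * r))) :
    Type :=
  SU p r n β ⧸ Subgroup.center (SU p r n β)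

end

/-!
A subgroup `H ≤ G` of index prime to `l` has the same essential `l`-dimension as `G`. Induction
sends `H`-torsors to `G`-torsors, and an `H`-structure on a `G`-torsor `A` is a rational point of
`Spec A^H`; as `A^H` has dimension `[G : H]`, one of its residue fields has degree prime to `l`, and
so an `H`-structure appears after an extension of degree prime to `l`.

An element of `GL_n` commuting with `SU` is scalar. If `l` does not divide both `n` and `q + 1`, the
center of `SU` therefore has order prime to `l`, so that a Sylow `l`-subgroup of `SU` embeds in
`PSU` with index prime to `l`. For an odd prime `l ∣ q + 1` the centers of `SU` and `SL_n`
correspond, so `PSU` embeds in `PSL_n`, and the index is prime to `l`: the monomial unitary matrices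
`(μ_{q+1})^n ⋊ S_n` already account for the whole `l`-part of the order of `GL_n`.
-/

/-! ### Galois actions and torsors -/

section GaloisAction

variable {R S G : Type*} [CommRing R] [CommRing S] [Algebra R S] [Group G]

open scoped Classical in
/-- Dual families witnessing that the action of `G` on `S` is Galois over its invariants (the
Chase–Harrison–Rosenberg criterion). -/
def IsDualSystem (ρ : G →* (S ≃ₐ[R] S)) {ι : Type*} [Fintype ι] (x y : ι → S) : Prop :=
  ∀ g, ∑ i, x i * ρ g (y i) = if g = 1 then 1 else 0

/-- The trace of the action of a finite group: the sum of the conjugates. -/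
def galoisTrace [Fintype G] (ρ : G →* (S ≃ₐ[R] S)) : S →ₗ[R] S :=
  ∑ g, (ρ g).toLinearMap

/-- The invariants of a group acting by algebra automorphisms. -/
def fixedSubalgebra (ρ : G →* (S ≃ₐ[R] S)) : Subalgebra R S :=
  FixedPoints.subalgebra R S ρ.range

/-- An action by algebra automorphisms, regarded as an action over the invariants. -/
def fixedAct (ρ : G →* (S ≃ₐ[R] S)) : G →* (S ≃ₐ[fixedSubalgebra ρ] S) where
  toFun g := AlgEquiv.ofRingEquiv (f := (ρ g : S ≃+* S)) fun c => c.2 ⟨ρ g, g, rfl⟩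
  map_one' := AlgEquiv.ext fun a => by simp
  map_mul' g h := AlgEquiv.ext fun a => DFunLike.congr_fun (map_mul ρ g h) a

/-- The action on `T ⊗ S` obtained from an action on `S` by extension of scalars. -/
def baseChangeAct (ρ : G →* (S ≃ₐ[R] S)) (T : Type*) [CommRing T] [Algebra R T] :
    G →* (T ⊗[R] S ≃ₐ[T] T ⊗[R] S) where
  toFun g := Algebra.TensorProduct.congr AlgEquiv.refl (ρ g)
  map_one' := AlgEquiv.coe_toAlgHom_injective (by ext; simp)
  map_mul' g h := AlgEquiv.coe_toAlgHom_injective (by ext; simp)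

variable {ρ : G →* (S ≃ₐ[R] S)} {T : Type*} [CommRing T] [Algebra R T]

theorem galoisTrace_apply [Fintype G] (a : S) : galoisTrace ρ a = ∑ g, ρ g a := by
  simp [galoisTrace]

theorem mem_fixedSubalgebra {a : S} : a ∈ fixedSubalgebra ρ ↔ ∀ g, ρ g a = a :=
  ⟨fun h g => h ⟨ρ g, g, rfl⟩, fun h => by rintro ⟨_, g, rfl⟩; exact h g⟩

@[simp]
theorem fixedAct_apply (g : G) (a : S) : fixedAct ρ g a = ρ g a := rfl

theorem galoisTrace_mem_fixedSubalgebra [Fintype G] (a : S) :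
    galoisTrace ρ a ∈ fixedSubalgebra ρ := by
  refine mem_fixedSubalgebra.2 fun g => ?_
  simp only [galoisTrace_apply, map_sum, ← AlgEquiv.mul_apply, ← map_mul]
  exact Equiv.sum_comp (Equiv.mulLeft g) fun g => ρ g a

theorem galoisTrace_fixedAct_mem_bot [Fintype G] (a : S) :
    galoisTrace (fixedAct ρ) a ∈ (⊥ : Subalgebra (fixedSubalgebra ρ) S) :=
  ⟨⟨galoisTrace ρ a, galoisTrace_mem_fixedSubalgebra a⟩, by simp [galoisTrace_apply]⟩

theorem baseChangeAct_tmul (g : G) (c : T) (a : S) :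
    baseChangeAct ρ T g (c ⊗ₜ a) = c ⊗ₜ ρ g a := rfl

theorem galoisTrace_baseChangeAct_mem_bot [Fintype G]
    (htr : ∀ a, galoisTrace ρ a ∈ (⊥ : Subalgebra R S)) (t : T ⊗[R] S) :
    galoisTrace (baseChangeAct ρ T) t ∈ (⊥ : Subalgebra T (T ⊗[R] S)) := by
  induction t using TensorProduct.induction_on with
  | zero => rw [map_zero]; exact zero_mem _
  | add a b ha hb => rw [map_add]; exact add_mem ha hb
  | tmul c a =>
    obtain ⟨r, hr⟩ := Algebra.mem_bot.1 (htr a)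
    refine Algebra.mem_bot.2 ⟨r • c, ?_⟩
    simp only [galoisTrace_apply, baseChangeAct_tmul, ← TensorProduct.tmul_sum]
    rw [← galoisTrace_apply, ← hr, Algebra.algebraMap_eq_smul_one (A := S),
      ← TensorProduct.smul_tmul, Algebra.TensorProduct.algebraMap_apply,
      Algebra.algebraMap_self_apply]

namespace IsDualSystem

variable {ι : Type*} [Fintype ι] {x y : ι → S}

theorem comp (hxy : IsDualSystem ρ x y) {H : Type*} [Group H] {φ : H →* G}
    (hφ : Function.Injective φ) : IsDualSystem (ρ.comp φ) x y := fun h => by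
  classical exact (hxy (φ h)).trans (by simp only [map_eq_one_iff φ hφ])

theorem fixedAct (hxy : IsDualSystem ρ x y) : IsDualSystem (fixedAct ρ) x y :=
  hxy

theorem baseChange (hxy : IsDualSystem ρ x y) (T : Type*) [CommRing T] [Algebra R T] :
    IsDualSystem (baseChangeAct ρ T) (fun i => 1 ⊗ₜ x i) (fun i => 1 ⊗ₜ y i) := fun g => by
  simp only [baseChangeAct_tmul, Algebra.TensorProduct.tmul_mul_tmul, one_mul,
    ← TensorProduct.tmul_sum, hxy g]
  split_ifs
  · rfl
  · exact TensorProduct.tmul_zero _ _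

theorem sum_mul_galoisTrace [Fintype G] (hxy : IsDualSystem ρ x y) (a : S) :
    ∑ i, x i * galoisTrace ρ (y i * a) = a := by
  classical
  simp only [galoisTrace_apply, Finset.mul_sum, map_mul]
  rw [Finset.sum_comm]
  simp only [← mul_assoc, ← Finset.sum_mul, hxy _]
  simp

theorem span_range_eq_top [Fintype G] (hxy : IsDualSystem ρ x y)
    (htr : ∀ a, galoisTrace ρ a ∈ (⊥ : Subalgebra R S)) : Submodule.span R (Set.range x) = ⊤ := by
  refine eq_top_iff.2 fun a _ => ?_
  rw [← hxy.sum_mul_galoisTrace a]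
  refine Submodule.sum_mem _ fun i _ => ?_
  obtain ⟨c, hc⟩ := Algebra.mem_bot.1 (htr (y i * a))
  rw [← hc, mul_comm, ← Algebra.smul_def]
  exact Submodule.smul_mem _ c (Submodule.subset_span ⟨i, rfl⟩)

theorem finite [Fintype G] (hxy : IsDualSystem ρ x y)
    (htr : ∀ a, galoisTrace ρ a ∈ (⊥ : Subalgebra R S)) : Module.Finite R S :=
  ⟨Submodule.fg_def.2 ⟨_, Set.finite_range x, hxy.span_range_eq_top htr⟩⟩

theorem projective [Fintype G] [FaithfulSMul R S] (hxy : IsDualSystem ρ x y)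
    (htr : ∀ a, galoisTrace ρ a ∈ (⊥ : Subalgebra R S)) : Module.Projective R S := by
  let τ : S →ₗ[R] R := (galoisTrace ρ).codRestrictOfInjective (Algebra.linearMap R S)
    (FaithfulSMul.algebraMap_injective R S) fun a => Algebra.mem_bot.1 (htr a)
  have hτ (a : S) : algebraMap R S (τ a) = galoisTrace ρ a :=
    LinearMap.codRestrictOfInjective_comp_apply _ (Algebra.linearMap R S) _ _ a
  refine Module.Projective.of_split (LinearMap.pi fun i => τ ∘ₗ LinearMap.mulLeft R (y i))
    (Fintype.linearCombination R x) (LinearMap.ext fun a => ?_)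
  simpa [Fintype.linearCombination_apply, Algebra.smul_def, hτ, mul_comm] using
    hxy.sum_mul_galoisTrace a

theorem faithfullyFlat [Fintype G] [FaithfulSMul R S] (hxy : IsDualSystem ρ x y)
    (htr : ∀ a, galoisTrace ρ a ∈ (⊥ : Subalgebra R S)) : Module.FaithfullyFlat R S :=
  have := hxy.finite htr
  have := hxy.projective htr
  .of_comap_surjective (Algebra.IsIntegral.comap_surjective R S)

end IsDualSystem

end GaloisAction

namespace GAlgebra

section Criterion

variable {G : Type*} [Group G] {F : Type u} [Field F] {A : GAlgebra G F}

theorem torsorMap_tmul (A : GAlgebra G F) (a b : A.carrier) (g : G) :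
    A.torsorMap (a ⊗ₜ b) g = a * A.act g b := by
  simp [torsorMap]

theorem act_mul_apply (A : GAlgebra G F) (g h : G) (a : A.carrier) :
    A.act (g * h) a = A.act g (A.act h a) := by
  rw [map_mul, AlgEquiv.mul_apply]

theorem IsTorsor.exists_isDualSystem (hA : A.IsTorsor) :
    ∃ (ι : Type u) (_ : Fintype ι) (x y : ι → A.carrier), IsDualSystem A.act x y := by
  classical
  obtain ⟨t, ht⟩ := hA.bijective.2 fun g => if g = 1 then 1 else 0
  obtain ⟨S, rfl⟩ := TensorProduct.exists_finset t
  refine ⟨S, inferInstance, fun i => i.1.1, fun i => i.1.2, fun g => ?_⟩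
  rw [Finset.sum_coe_sort S fun i => i.1 * A.act g i.2, ← congrFun ht g, map_sum, Finset.sum_apply]
  simp only [torsorMap_tmul]

theorem IsTorsor.fixedSubalgebra_eq_bot (hA : A.IsTorsor) : fixedSubalgebra A.act = ⊥ := by
  have := hA.nontrivial
  refine eq_bot_iff.2 fun a ha => ?_
  have h : a ⊗ₜ[F] (1 : A.carrier) = (1 : A.carrier) ⊗ₜ[F] a :=
    hA.bijective.1 <| funext fun g => by simp [torsorMap_tmul, mem_fixedSubalgebra.1 ha g]
  obtain ⟨f, hf⟩ := Module.Projective.exists_dual_ne_zero F (one_ne_zero (α := A.carrier))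
  have hfa : f 1 • a = f a • 1 := by
    simpa using congrArg (TensorProduct.lift ((LinearMap.lsmul F A.carrier).flip.compl₂ f)) h
  refine Algebra.mem_bot.2 ⟨(f 1)⁻¹ * f a, ?_⟩
  rw [Algebra.algebraMap_eq_smul_one, mul_smul, ← hfa,
    inv_smul_smul₀ hf]

theorem IsTorsor.galoisTrace_mem_bot [Fintype G] (hA : A.IsTorsor) (a : A.carrier) :
    galoisTrace A.act a ∈ (⊥ : Subalgebra F A.carrier) :=
  hA.fixedSubalgebra_eq_bot ▸ galoisTrace_mem_fixedSubalgebra a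

end Criterion

end GAlgebra

namespace IsDualSystem

variable {G : Type*} [Group G] {F : Type u} [Field F] {A : GAlgebra G F} {ι : Type*} [Fintype ι]
  {x y : ι → A.carrier}

theorem torsorMap_surjective [Finite G] (hxy : IsDualSystem A.act x y) :
    Function.Surjective A.torsorMap := fun u => by
  classical
  have := Fintype.ofFinite G
  refine ⟨∑ g, ∑ i, (u g * x i) ⊗ₜ A.act g⁻¹ (y i), funext fun g' => ?_⟩
  simp only [map_sum, Finset.sum_apply, GAlgebra.torsorMap_tmul, mul_assoc,
    ← GAlgebra.act_mul_apply, ← Finset.mul_sum, hxy _]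
  simp [mul_inv_eq_one]

variable [Fintype G]

theorem sum_torsorMap_tmul (hxy : IsDualSystem A.act x y)
    (htr : ∀ a, galoisTrace A.act a ∈ (⊥ : Subalgebra F A.carrier))
    (t : A.carrier ⊗[F] A.carrier) :
    ∑ i, (∑ g, A.act g (y i) * A.torsorMap t g) ⊗ₜ[F] x i = t := by
  induction t using TensorProduct.induction_on with
  | zero => simp
  | add t u ht hu =>
    simp only [map_add, Pi.add_apply, mul_add, Finset.sum_add_distrib, TensorProduct.add_tmul,
      ht, hu]
  | tmul a b =>
    conv_rhs => rw [← hxy.sum_mul_galoisTrace b, TensorProduct.tmul_sum]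
    refine Finset.sum_congr rfl fun i _ => ?_
    have hi : ∑ g, A.act g (y i) * A.torsorMap (a ⊗ₜ b) g = a * galoisTrace A.act (y i * b) := by
      simp only [GAlgebra.torsorMap_tmul, galoisTrace_apply, map_mul, Finset.mul_sum,
        mul_left_comm a]
    obtain ⟨c, hc⟩ := Algebra.mem_bot.1 (htr (y i * b))
    rw [hi, ← hc, mul_comm a, mul_comm (x i), ← Algebra.smul_def, ← Algebra.smul_def,
      TensorProduct.smul_tmul]

theorem isTorsor [Nontrivial A.carrier] (hxy : IsDualSystem A.act x y)
    (htr : ∀ a, galoisTrace A.act a ∈ (⊥ : Subalgebra F A.carrier)) : A.IsTorsor where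
  nontrivial := inferInstance
  finite := hxy.finite htr
  bijective := by
    refine ⟨(injective_iff_map_eq_zero _).2 fun t ht => ?_, hxy.torsorMap_surjective⟩
    rw [← hxy.sum_torsorMap_tmul htr t, ht]
    simp

end IsDualSystem

namespace GAlgebra

section ReducesTo

variable {G H J : Type*} [Group G] [Group H] [Group J] {F K L : Type u} [Field F] [Field K]
  [Field L]

/-- There is a ring homomorphism from `A` to `B` over `ι : F → K` that is equivariant along
`φ : H → G`. For torsors this says that `B` is a reduction of the structure group of `A_K` to
`H`. -/
def ReducesTo (A : GAlgebra G F) (φ : H →* G) (ι : F →+* K) (B : GAlgebra H K) : Prop :=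
  ∃ f : A.carrier →+* B.carrier,
    (∀ c, f (algebraMap F A.carrier c) = algebraMap K B.carrier (ι c)) ∧
      ∀ h a, f (A.act (φ h) a) = B.act h (f a)

theorem ReducesTo.trans {φ : H →* G} {ψ : J →* H} {ι : F →+* K} {κ : K →+* L} {A : GAlgebra G F}
    {B : GAlgebra H K} {C : GAlgebra J L} (h₁ : A.ReducesTo φ ι B) (h₂ : B.ReducesTo ψ κ C) :
    A.ReducesTo (φ.comp ψ) (κ.comp ι) C := by
  obtain ⟨f, hf, hf'⟩ := h₁
  obtain ⟨g, hg, hg'⟩ := h₂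
  exact ⟨g.comp f, fun c => by simp [hf, hg], fun j a => by simp [hf', hg']⟩

theorem Iso.reducesTo {A B : GAlgebra G F} (h : A.Iso B) :
    A.ReducesTo (MonoidHom.id G) (RingHom.id F) B := by
  obtain ⟨e, he⟩ := h
  exact ⟨e, e.commutes, he⟩

theorem Iso.symm {A B : GAlgebra G F} (h : A.Iso B) : B.Iso A := by
  obtain ⟨e, he⟩ := h
  exact ⟨e.symm, fun g b => by rw [AlgEquiv.symm_apply_eq, he, AlgEquiv.apply_symm_apply]⟩

theorem Iso.trans {A B C : GAlgebra G F} (h : A.Iso B) (h' : B.Iso C) : A.Iso C := by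
  obtain ⟨e, he⟩ := h
  obtain ⟨e', he'⟩ := h'
  exact ⟨e.trans e', fun g b => by simp [he, he']⟩

theorem ReducesTo.iso [Finite G] {A B : GAlgebra G F} (hA : A.IsTorsor) (hB : B.IsTorsor)
    (h : A.ReducesTo (MonoidHom.id G) (RingHom.id F) B) : A.Iso B := by
  have := Fintype.ofFinite G
  have := hB.nontrivial
  obtain ⟨f, hf, hf'⟩ := h
  obtain ⟨ι, _, x, y, hxy⟩ := hA.exists_isDualSystem
  have hfxy : IsDualSystem B.act (f ∘ x) (f ∘ y) := fun g => by
    have := congrArg f (hxy g)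
    rw [map_sum, apply_ite f, map_one, map_zero] at this
    simpa only [Function.comp_apply, map_mul, ← hf', MonoidHom.id_apply] using this
  have hftr (a : A.carrier) : f (galoisTrace A.act a) = galoisTrace B.act (f a) := by
    simp only [galoisTrace_apply, map_sum, ← hf', MonoidHom.id_apply]
  refine ⟨AlgEquiv.ofBijective { f with commutes' := hf }
    ⟨(injective_iff_map_eq_zero _).2 fun a (ha : f a = 0) => ?_, fun b => ?_⟩, hf'⟩
  · rw [← hxy.sum_mul_galoisTrace a]
    refine Finset.sum_eq_zero fun i _ => ?_
    obtain ⟨c, hc⟩ := Algebra.mem_bot.1 (hA.galoisTrace_mem_bot (y i * a))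
    have h0 : algebraMap F B.carrier c = 0 :=
      calc algebraMap F B.carrier c = f (galoisTrace A.act (y i * a)) := by rw [← hc, hf]; rfl
        _ = 0 := by rw [hftr, map_mul, ha, mul_zero, map_zero]
    rw [← hc, (map_eq_zero _).1 h0, map_zero, mul_zero]
  · choose τ hτ using fun b => Algebra.mem_bot.1 (hB.galoisTrace_mem_bot b)
    refine ⟨∑ i, x i * algebraMap F A.carrier (τ (f (y i) * b)), ?_⟩
    change f _ = b
    simp only [map_sum, map_mul, hf, RingHom.id_apply, hτ]
    exact hfxy.sum_mul_galoisTrace b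

end ReducesTo

section ExtendScalars

variable {R : Type*} {S K L : Type u} [CommRing R] [CommRing S] [Algebra R S] [Field K] [Field L]
  [Algebra R K] {G : Type*} [Group G]

/-- Extension of scalars along a `K`-point of `Spec R` of an algebra with an action of `G` over an
arbitrary ring `R`; over a field this is `GAlgebra.baseChange`. -/
def extendScalars (ρ : G →* (S ≃ₐ[R] S)) (K : Type u) [Field K] [Algebra R K] : GAlgebra G K where
  carrier := K ⊗[R] S
  act := baseChangeAct ρ K

variable {ρ : G →* (S ≃ₐ[R] S)}

theorem isTorsor_extendScalars [Fintype G] {ι : Type*} [Fintype ι] {x y : ι → S}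
    (hxy : IsDualSystem ρ x y) (htr : ∀ a, galoisTrace ρ a ∈ (⊥ : Subalgebra R S))
    [FaithfulSMul R S] : (extendScalars ρ K).IsTorsor :=
  have := hxy.faithfullyFlat htr
  have : Nontrivial (extendScalars ρ K).carrier := inferInstanceAs (Nontrivial (K ⊗[R] S))
  (hxy.baseChange K).isTorsor (A := extendScalars ρ K) (galoisTrace_baseChangeAct_mem_bot htr)

theorem extendScalars_reducesTo {H : Type*} [Group H] {φ : H →* G} {κ : K →+* L}
    {B : GAlgebra H L} (f : S →+* B.carrier)
    (hf : ∀ r, f (algebraMap R S r) = algebraMap L B.carrier (κ (algebraMap R K r)))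
    (hf' : ∀ h a, f (ρ (φ h) a) = B.act h (f a)) :
    (extendScalars ρ K).ReducesTo φ κ B := by
  let : Algebra R B.carrier := (f.comp (algebraMap R S)).toAlgebra
  let f₁ : K →ₐ[R] B.carrier :=
    { (algebraMap L B.carrier).comp κ with commutes' := fun r => (hf r).symm }
  let f₂ : S →ₐ[R] B.carrier := { f with commutes' := fun r => rfl }
  let Φ : K ⊗[R] S →ₐ[R] B.carrier := Algebra.TensorProduct.lift f₁ f₂ fun _ _ => Commute.all _ _
  have hΦ (c : K) (a : S) : Φ (c ⊗ₜ[R] a) = algebraMap L B.carrier (κ c) * f a :=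
    Algebra.TensorProduct.lift_tmul f₁ f₂ (fun _ _ => Commute.all _ _) c a
  have hact (h : H) (t : K ⊗[R] S) : Φ (baseChangeAct ρ K (φ h) t) = B.act h (Φ t) := by
    induction t using TensorProduct.induction_on with
    | zero => simp only [map_zero]
    | add a b ha hb => simp only [map_add, ha, hb]
    | tmul c a => simp only [baseChangeAct_tmul, hΦ, hf', map_mul, AlgEquiv.commutes]
  exact ⟨Φ.toRingHom, fun c => (hΦ c 1).trans (by rw [map_one, mul_one]), hact⟩

end ExtendScalars

section BaseChange

variable {G H : Type*} [Group G] [Group H] {F K : Type u} [Field F] [Field K] [Algebra F K]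

theorem reducesTo_baseChange (A : GAlgebra G F) (K : Type u) [Field K] [Algebra F K] :
    A.ReducesTo (MonoidHom.id G) (algebraMap F K) (A.baseChange K) :=
  ⟨(Algebra.TensorProduct.includeRight : A.carrier →ₐ[F] K ⊗[F] A.carrier).toRingHom,
    fun c => Algebra.TensorProduct.tmul_one_eq_one_tmul c |>.symm, fun _ _ => rfl⟩

theorem ReducesTo.baseChange {φ : H →* G} {A : GAlgebra G F} {B : GAlgebra H K}
    (h : A.ReducesTo φ (algebraMap F K) B) :
    (A.baseChange K).ReducesTo φ (RingHom.id K) B := by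
  obtain ⟨f, hf, hf'⟩ := h
  exact extendScalars_reducesTo (ρ := A.act) (κ := RingHom.id K) f hf hf'

theorem IsTorsor.baseChange [Finite G] {A : GAlgebra G F} (hA : A.IsTorsor) (K : Type u) [Field K]
    [Algebra F K] : (A.baseChange K).IsTorsor := by
  have := Fintype.ofFinite G
  have := hA.nontrivial
  obtain ⟨ι, _, x, y, hxy⟩ := hA.exists_isDualSystem
  exact isTorsor_extendScalars (K := K) hxy hA.galoisTrace_mem_bot

end BaseChange

end GAlgebra

/-! ### Induction and reduction of torsors -/

section CosetEquiv

variable {G H : Type*} [Group G] [Group H] {φ : H →* G}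

theorem exists_out_mul_map_eq (φ : H →* G) (g : G) : ∃ h, (g : G ⧸ φ.range).out * φ h = g := by
  obtain ⟨⟨_, h, rfl⟩, hh⟩ := QuotientGroup.mk_out_eq_mul φ.range g
  exact ⟨h⁻¹, by rw [hh, map_inv, mul_inv_cancel_right]⟩

/-- The decomposition of `G` into the left cosets of the image of `H`, each of which is identified
with `H` by means of its chosen representative. -/
noncomputable def cosetEquiv (hφ : Function.Injective φ) : (G ⧸ φ.range) × H ≃ G :=
  Equiv.ofBijective (fun p => p.1.out * φ p.2) <| by
    refine ⟨fun ⟨c, h⟩ ⟨c', h'⟩ hp => ?_, fun g => ?_⟩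
    · have hc : c = c' := by
        simpa using congrArg (QuotientGroup.mk (s := φ.range)) hp
      subst hc
      exact congrArg (c, ·) (hφ (mul_left_cancel hp))
    · obtain ⟨h, hh⟩ := exists_out_mul_map_eq φ g
      exact ⟨(g, h), hh⟩

variable (hφ : Function.Injective φ)

theorem cosetEquiv_apply (c : G ⧸ φ.range) (h : H) : cosetEquiv hφ (c, h) = c.out * φ h := rfl

theorem cosetEquiv_symm_mul_map (g : G) (h : H) :
    (cosetEquiv hφ).symm (g * φ h) =
      (((cosetEquiv hφ).symm g).1, ((cosetEquiv hφ).symm g).2 * h) := by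
  obtain ⟨⟨c, h'⟩, rfl⟩ := (cosetEquiv hφ).surjective g
  rw [Equiv.symm_apply_eq, Equiv.symm_apply_apply]
  simp only [cosetEquiv_apply, map_mul, mul_assoc]

end CosetEquiv

namespace GAlgebra

section Induced

variable {G : Type} {H : Type*} [Group G] [Group H] {F : Type u} [Field F] {φ : H →* G}
  {B : GAlgebra H F}

/-- The functions `f : G → B` with `f (g * φ h) = h⁻¹ (f g)`. -/
def inducedSubalgebra (φ : H →* G) (B : GAlgebra H F) : Subalgebra F (G → B.carrier) where
  carrier := {f | ∀ g h, f (g * φ h) = B.act h⁻¹ (f g)}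
  mul_mem' ha hb g h := by simp only [Pi.mul_apply, ha g h, hb g h, map_mul]
  add_mem' ha hb g h := by simp only [Pi.add_apply, ha g h, hb g h, map_add]
  algebraMap_mem' c g h := by simp only [Pi.algebraMap_apply, AlgEquiv.commutes]

/-- The action of `g` on the functions in `inducedSubalgebra`, by `f ↦ (x ↦ f (g⁻¹ * x))`. -/
def inducedAct (φ : H →* G) (B : GAlgebra H F) (g : G) :
    inducedSubalgebra φ B →ₐ[F] inducedSubalgebra φ B where
  toFun f := ⟨fun x => f.1 (g⁻¹ * x), fun x h => by
    simpa only [mul_assoc] using f.2 (g⁻¹ * x) h⟩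
  map_one' := rfl
  map_mul' _ _ := rfl
  map_zero' := rfl
  map_add' _ _ := rfl
  commutes' _ := rfl

theorem inducedAct_apply (g : G) (f : inducedSubalgebra φ B) (x : G) :
    (inducedAct φ B g f).1 x = f.1 (g⁻¹ * x) := rfl

/-- The `G`-algebra induced along `φ : H → G` from an `H`-algebra; on spectra it is the contracted
product of `Spec B` with `G`. -/
def induced (φ : H →* G) (B : GAlgebra H F) : GAlgebra G F where
  carrier := inducedSubalgebra φ B
  act :=
    { toFun := fun g => AlgEquiv.ofAlgHom (inducedAct φ B g) (inducedAct φ B g⁻¹)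
        (by ext; simp [inducedAct_apply]) (by ext; simp [inducedAct_apply])
      map_one' := by ext; simp [inducedAct_apply]
      map_mul' := fun g g' => by ext; simp [inducedAct_apply, mul_assoc] }

/-- Evaluation of the functions in `induced φ B` at a point of `G`. -/
def inducedEval (φ : H →* G) (B : GAlgebra H F) (x : G) : (induced φ B).carrier →ₐ[F] B.carrier :=
  (Pi.evalAlgHom F (fun _ : G => B.carrier) x).comp (inducedSubalgebra φ B).val

theorem inducedEval_act (g : G) (f : (induced φ B).carrier) (x : G) :
    inducedEval φ B x ((induced φ B).act g f) = inducedEval φ B (g⁻¹ * x) f := rfl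

theorem inducedEval_mul_map (f : (induced φ B).carrier) (x : G) (h : H) :
    inducedEval φ B (x * φ h) f = B.act h⁻¹ (inducedEval φ B x f) := f.2 x h

theorem induced_ext {f f' : (induced φ B).carrier}
    (h : ∀ x, inducedEval φ B x f = inducedEval φ B x f') : f = f' :=
  Subtype.ext (funext h)

theorem induced_reducesTo (φ : H →* G) (B : GAlgebra H F) :
    (induced φ B).ReducesTo φ (RingHom.id F) B :=
  ⟨(inducedEval φ B 1).toRingHom, (inducedEval φ B 1).commutes, fun h f =>
    calc inducedEval φ B ((φ h)⁻¹ * 1) f = inducedEval φ B (1 * φ h⁻¹) f := by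
          rw [map_inv, mul_one, one_mul]
      _ = B.act h (inducedEval φ B 1 f) := by rw [inducedEval_mul_map, inv_inv]⟩

theorem ReducesTo.reducesTo_induced {A : GAlgebra G F} (hAB : A.ReducesTo φ (RingHom.id F) B) :
    A.ReducesTo (MonoidHom.id G) (RingHom.id F) (induced φ B) := by
  obtain ⟨f, hf, hf'⟩ := hAB
  let Φ : A.carrier →+* (induced φ B).carrier := RingHom.codRestrict
    (RingHom.pi fun g : G => f.comp (A.act g⁻¹ : A.carrier →+* A.carrier))
    (inducedSubalgebra φ B) fun a g h => by
      change f (A.act (g * φ h)⁻¹ a) = B.act h⁻¹ (f (A.act g⁻¹ a))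
      rw [← hf', mul_inv_rev, act_mul_apply, map_inv φ]
  have hΦ (x : G) (a : A.carrier) : inducedEval φ B x (Φ a) = f (A.act x⁻¹ a) := rfl
  refine ⟨Φ, fun c => induced_ext fun x => ?_, fun g a => induced_ext fun x => ?_⟩
  · rw [hΦ, AlgEquiv.commutes, hf, AlgHom.commutes]
  · rw [inducedEval_act, hΦ, hΦ, ← act_mul_apply, mul_inv_rev, inv_inv, MonoidHom.id_apply]

open scoped Classical in
/-- The element of `induced φ B` that is supported on the coset `c` and takes the value `z` at the
chosen representative of `c`. -/
noncomputable def inducedSingle (hφ : Function.Injective φ) (c : G ⧸ φ.range) (z : B.carrier) :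
    (induced φ B).carrier :=
  ⟨fun g => if ((cosetEquiv hφ).symm g).1 = c then B.act ((cosetEquiv hφ).symm g).2⁻¹ z else 0,
    fun g h => by
      simp only [cosetEquiv_symm_mul_map, mul_inv_rev, act_mul_apply]
      split_ifs
      · rfl
      · rw [map_zero]⟩

open scoped Classical in
theorem inducedEval_inducedSingle (hφ : Function.Injective φ) (c d : G ⧸ φ.range) (h : H)
    (z : B.carrier) : inducedEval φ B (cosetEquiv hφ (c, h)) (inducedSingle hφ d z) =
      if c = d then B.act h⁻¹ z else 0 := by
  change (if ((cosetEquiv hφ).symm (cosetEquiv hφ (c, h))).1 = d then _ else _) = _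
  rw [Equiv.symm_apply_apply]

open scoped Classical in
theorem sum_inducedEval_inducedSingle_mul [Fintype (G ⧸ φ.range)] {ι : Type*} [Fintype ι]
    {x y : ι → B.carrier} (hxy : IsDualSystem B.act x y) (hφ : Function.Injective φ) (a b : G) :
    ∑ i : ι × (G ⧸ φ.range), inducedEval φ B a (inducedSingle hφ i.2 (x i.1)) *
      inducedEval φ B b (inducedSingle hφ i.2 (y i.1)) = if a = b then 1 else 0 := by
  obtain ⟨⟨c, h⟩, rfl⟩ := (cosetEquiv hφ).surjective a
  obtain ⟨⟨d, j⟩, rfl⟩ := (cosetEquiv hφ).surjective b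
  have hterm (i : ι) : B.act h⁻¹ (x i) * B.act j⁻¹ (y i) =
      B.act h⁻¹ (x i * B.act (h * j⁻¹) (y i)) := by
    rw [map_mul, ← act_mul_apply, inv_mul_cancel_left]
  have hsum : ∑ i, B.act h⁻¹ (x i) * B.act j⁻¹ (y i) = if h = j then 1 else 0 := by
    simp only [hterm, ← map_sum, hxy _, mul_inv_eq_one]
    split_ifs
    · exact map_one _
    · exact map_zero _
  simp only [inducedEval_inducedSingle, Fintype.sum_prod_type_right, ite_mul, mul_ite, mul_zero,
    zero_mul, Finset.sum_ite_irrel, Finset.sum_const_zero, hsum, Finset.sum_ite_eq,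
    Finset.mem_univ, if_true, Equiv.apply_eq_iff_eq, Prod.mk.injEq, ite_and]

theorem sum_inducedEval_eq_galoisTrace [Fintype G] [Fintype H] [Fintype (G ⧸ φ.range)]
    (hφ : Function.Injective φ) (f : (induced φ B).carrier) :
    ∑ x, inducedEval φ B x f =
      galoisTrace B.act (∑ c : G ⧸ φ.range, inducedEval φ B c.out f) := by
  rw [← (cosetEquiv hφ).sum_comp, Fintype.sum_prod_type, map_sum]
  refine Finset.sum_congr rfl fun c _ => ?_
  simp only [cosetEquiv_apply, inducedEval_mul_map, galoisTrace_apply]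
  exact Equiv.sum_comp (Equiv.inv H) fun h => B.act h (inducedEval φ B c.out f)

theorem IsTorsor.induced [Finite G] {B : GAlgebra H F} (hB : B.IsTorsor)
    (hφ : Function.Injective φ) : (induced φ B).IsTorsor := by
  classical
  have := Fintype.ofFinite G
  have := Finite.of_injective φ hφ
  have := Fintype.ofFinite H
  have := hB.nontrivial
  have : Nontrivial (GAlgebra.induced φ B).carrier :=
    (inducedEval φ B 1).toRingHom.domain_nontrivial
  obtain ⟨ι, _, x, y, hxy⟩ := hB.exists_isDualSystem
  refine IsDualSystem.isTorsor (x := fun i : ι × (G ⧸ φ.range) => inducedSingle hφ i.2 (x i.1))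
    (y := fun i => inducedSingle hφ i.2 (y i.1)) (fun g => induced_ext fun a => ?_) fun f => ?_
  · simp only [map_sum, map_mul, inducedEval_act, sum_inducedEval_inducedSingle_mul hxy hφ,
      apply_ite (inducedEval φ B a), map_one, map_zero, right_eq_mul, inv_eq_one]
  · obtain ⟨c, hc⟩ := Algebra.mem_bot.1 (hB.galoisTrace_mem_bot (∑ d : G ⧸ φ.range,
      inducedEval φ B d.out f))
    refine Algebra.mem_bot.2 ⟨c, induced_ext fun a => ?_⟩
    rw [AlgHom.commutes, hc, ← sum_inducedEval_eq_galoisTrace hφ, galoisTrace_apply, map_sum]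
    exact (Equiv.sum_comp ((Equiv.inv G).trans (Equiv.mulRight a))
      fun g => inducedEval φ B g f).symm

theorem ReducesTo.iso_induced [Finite G] {A : GAlgebra G F} {B : GAlgebra H F} (hA : A.IsTorsor)
    (hB : B.IsTorsor) (hφ : Function.Injective φ) (hAB : A.ReducesTo φ (RingHom.id F) B) :
    A.Iso (GAlgebra.induced φ B) :=
  hAB.reducesTo_induced.iso hA (hB.induced hφ)

end Induced

end GAlgebra

theorem exists_isMaximal_not_dvd_finrank {F C : Type*} [Field F] [CommRing C] [Algebra F C]
    [Module.Finite F C] {l : ℕ} (hl : ¬ l ∣ Module.finrank F C) :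
    ∃ m : Ideal C, m.IsMaximal ∧ ¬ l ∣ Module.finrank F (C ⧸ m) := by
  by_contra! hcon
  have : IsArtinianRing C := IsArtinianRing.of_finite F C
  refine hl (IsNoetherianRing.induction_on_isQuotientEquivQuotientPrime C
    (inferInstance : Module.Finite C C)
    (motive := fun N _ _ _ => ∀ (_ : Module F N), IsScalarTower F C N → l ∣ Module.finrank F N)
    ?_ ?_ ?_ inferInstance inferInstance)
  · intro N _ _ _ _ _ _
    rw [Module.finrank_zero_of_subsingleton]
    exact dvd_zero l
  · intro N _ _ _ p e _ _
    rw [(e.restrictScalars F).finrank_eq]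
    exact hcon p.asIdeal inferInstance
  · intro N₁ _ _ _ N₂ _ _ _ N₃ _ _ _ f g hf hg hfg h₁ h₃ _ _
    let : Module F N₁ := Module.compHom N₁ (algebraMap F C)
    let : Module F N₃ := Module.compHom N₃ (algebraMap F C)
    have : IsScalarTower F C N₁ := ⟨fun a b x => by rw [Algebra.smul_def, mul_smul]; rfl⟩
    have : IsScalarTower F C N₃ := ⟨fun a b x => by rw [Algebra.smul_def, mul_smul]; rfl⟩
    have : Module.Finite F N₂ := Module.Finite.trans C N₂
    have hrank : Module.finrank F N₃ + Module.finrank F N₁ = Module.finrank F N₂ := by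
      rw [← LinearMap.finrank_range_add_finrank_ker (g.restrictScalars F),
        (LinearMap.range_eq_top (f := g.restrictScalars F)).2 hg, finrank_top,
        (LinearMap.exact_iff (f := f.restrictScalars F) (g := g.restrictScalars F)).1 hfg,
        LinearMap.finrank_range_of_inj (f := f.restrictScalars F) hf]
    exact hrank ▸ dvd_add (h₃ _ inferInstance) (h₁ _ inferInstance)

namespace GAlgebra

section Fixed

variable {G H : Type*} [Group G] [Group H] {F : Type u} [Field F]

/-- The map `A ⊗ A ^ H → ∏_{c ∈ G / H} A` obtained from `torsorMap` by restricting to the chosen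
representatives of the cosets. -/
noncomputable def cosetTorsorMap (A : GAlgebra G F) (φ : H →* G) :
    A.carrier ⊗[F] fixedSubalgebra (A.act.comp φ) →ₗ[F] (G ⧸ φ.range → A.carrier) :=
  LinearMap.funLeft F A.carrier Quotient.out ∘ₗ A.torsorMap.toLinearMap ∘ₗ
    LinearMap.lTensor A.carrier (fixedSubalgebra (A.act.comp φ)).val.toLinearMap

variable {A : GAlgebra G F} {φ : H →* G}

theorem cosetTorsorMap_tmul (a : A.carrier) (b : fixedSubalgebra (A.act.comp φ))
    (c : G ⧸ φ.range) : A.cosetTorsorMap φ (a ⊗ₜ b) c = a * A.act c.out b :=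
  torsorMap_tmul A a b c.out

theorem cosetTorsorMap_mk (t : A.carrier ⊗[F] fixedSubalgebra (A.act.comp φ)) (g : G) :
    A.cosetTorsorMap φ t g = A.torsorMap
      (LinearMap.lTensor A.carrier (fixedSubalgebra (A.act.comp φ)).val.toLinearMap t) g := by
  induction t using TensorProduct.induction_on with
  | zero => simp
  | add a b ha hb => simp only [map_add, Pi.add_apply, ha, hb]
  | tmul a b =>
    obtain ⟨h, hh⟩ := exists_out_mul_map_eq φ g
    have hact : A.act g b = A.act (g : G ⧸ φ.range).out b :=
      calc A.act g b = A.act (g : G ⧸ φ.range).out (A.act (φ h) b) := by rw [← act_mul_apply, hh]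
        _ = A.act (g : G ⧸ φ.range).out b := congrArg _ (mem_fixedSubalgebra.1 b.2 h)
    exact (cosetTorsorMap_tmul a b g).trans (hact ▸ (torsorMap_tmul A a b g).symm)

theorem IsTorsor.cosetTorsorMap_injective (hA : A.IsTorsor) (φ : H →* G) :
    Function.Injective (A.cosetTorsorMap φ) := by
  refine (injective_iff_map_eq_zero _).2 fun t ht => ?_
  refine Module.Flat.lTensor_preserves_injective_linearMap (M := A.carrier)
    (fixedSubalgebra (A.act.comp φ)).val.toLinearMap Subtype.val_injective <|
    hA.bijective.1 <| funext fun g => ?_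
  rw [← cosetTorsorMap_mk, ht, map_zero, map_zero, Pi.zero_apply, Pi.zero_apply]

theorem IsTorsor.cosetTorsorMap_surjective [Finite G] (hA : A.IsTorsor)
    (hφ : Function.Injective φ) : Function.Surjective (A.cosetTorsorMap φ) := fun w => by
  classical
  have := Fintype.ofFinite G
  have := Finite.of_injective φ hφ
  have := Fintype.ofFinite H
  obtain ⟨ι, _, x, y, hxy⟩ := hA.exists_isDualSystem
  let z (d : G ⧸ φ.range) (i : ι) : fixedSubalgebra (A.act.comp φ) :=
    ⟨galoisTrace (A.act.comp φ) (A.act d.out⁻¹ (y i)), galoisTrace_mem_fixedSubalgebra _⟩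
  have hz (c d : G ⧸ φ.range) : ∑ i, x i * A.act c.out (z d i) = if c = d then 1 else 0 :=
    calc ∑ i, x i * A.act c.out (z d i)
      _ = ∑ h, ∑ i, x i * A.act (c.out * φ h * d.out⁻¹) (y i) := by
        rw [Finset.sum_comm]
        simp only [z, galoisTrace_apply, map_sum, MonoidHom.comp_apply, ← act_mul_apply,
          Finset.mul_sum, mul_assoc]
      _ = ∑ h, if cosetEquiv hφ (c, h) = cosetEquiv hφ (d, 1) then 1 else 0 := by
        simp only [hxy _, mul_inv_eq_one, cosetEquiv_apply, map_one, mul_one]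
      _ = if c = d then 1 else 0 := by
        simp only [Equiv.apply_eq_iff_eq, Prod.mk.injEq, ite_and, Finset.sum_ite_irrel,
          Finset.sum_const_zero, Finset.sum_ite_eq', Finset.mem_univ, if_true]
  refine ⟨∑ d, ∑ i, (w d * x i) ⊗ₜ z d i, funext fun c => ?_⟩
  simp only [map_sum, Finset.sum_apply, cosetTorsorMap_tmul, mul_assoc, ← Finset.mul_sum, hz,
    mul_ite, mul_one, mul_zero, Finset.sum_ite_eq, Finset.mem_univ, if_true]

theorem IsTorsor.finrank_fixedSubalgebra [Finite G] (hA : A.IsTorsor)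
    (hφ : Function.Injective φ) :
    Module.finrank F (fixedSubalgebra (A.act.comp φ)) = φ.range.index := by
  have := Fintype.ofFinite (G ⧸ φ.range)
  have := hA.nontrivial
  have := hA.finite
  have hrank := (LinearEquiv.ofBijective (A.cosetTorsorMap φ)
    ⟨hA.cosetTorsorMap_injective φ, hA.cosetTorsorMap_surjective hφ⟩).finrank_eq
  rw [Module.finrank_tensorProduct, Module.finrank_pi_fintype, Finset.sum_const, Finset.card_univ,
    smul_eq_mul, mul_comm] at hrank
  rw [Nat.eq_of_mul_eq_mul_right Module.finrank_pos hrank, Subgroup.index,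
    Nat.card_eq_fintype_card]

end Fixed

section Reduction

variable {G H : Type*} [Group G] [Group H] {F K : Type u} [Field F] [Field K]
  {A : GAlgebra G F} {φ : H →* G} [Algebra (fixedSubalgebra (A.act.comp φ)) K]

/-- The fibre of a `G`-algebra over a `K`-point of the quotient of its spectrum by `H`, as an
`H`-algebra over `K`. -/
def reduction (A : GAlgebra G F) (φ : H →* G) (K : Type u) [Field K]
    [Algebra (fixedSubalgebra (A.act.comp φ)) K] : GAlgebra H K :=
  extendScalars (fixedAct (A.act.comp φ)) K

theorem reducesTo_reduction [Algebra F K]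
    [IsScalarTower F (fixedSubalgebra (A.act.comp φ)) K] :
    A.ReducesTo φ (algebraMap F K) (A.reduction φ K) :=
  ⟨(Algebra.TensorProduct.includeRight : A.carrier →ₐ[fixedSubalgebra (A.act.comp φ)]
      K ⊗[fixedSubalgebra (A.act.comp φ)] A.carrier).toRingHom, fun c => by
    rw [IsScalarTower.algebraMap_apply F (fixedSubalgebra (A.act.comp φ)) K]
    exact (Algebra.TensorProduct.tmul_one_eq_one_tmul
      (algebraMap F (fixedSubalgebra (A.act.comp φ)) c)).symm, fun _ _ => rfl⟩

theorem IsTorsor.reduction [Finite H] (hA : A.IsTorsor) (hφ : Function.Injective φ) (K : Type u)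
    [Field K] [Algebra (fixedSubalgebra (A.act.comp φ)) K] : (A.reduction φ K).IsTorsor := by
  have := Fintype.ofFinite H
  obtain ⟨ι, _, x, y, hxy⟩ := hA.exists_isDualSystem
  exact isTorsor_extendScalars (hxy.comp hφ).fixedAct galoisTrace_fixedAct_mem_bot

theorem IsTorsor.exists_reducesTo_not_dvd_finrank [Finite G] (hA : A.IsTorsor)
    (hφ : Function.Injective φ) {l : ℕ} (hindex : ¬ l ∣ φ.range.index) :
    ∃ (K : Type u) (_ : Field K) (_ : Algebra F K) (B : GAlgebra H K), FiniteDimensional F K ∧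
      ¬ l ∣ Module.finrank F K ∧ B.IsTorsor ∧ A.ReducesTo φ (algebraMap F K) B := by
  have := hA.finite
  have := Finite.of_injective φ hφ
  rw [← hA.finrank_fixedSubalgebra hφ] at hindex
  obtain ⟨m, hm, hlm⟩ := exists_isMaximal_not_dvd_finrank hindex
  let := Ideal.Quotient.field m
  exact ⟨fixedSubalgebra (A.act.comp φ) ⧸ m, inferInstance, inferInstance, A.reduction φ _,
    inferInstance, hlm, hA.reduction hφ _, reducesTo_reduction⟩

end Reduction

end GAlgebra

open Algebra in
theorem trdeg_eq_of_isAlgebraic (k : Type*) (E E' : Type u) [Field k] [Field E] [Field E']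
    [Algebra k E] [Algebra k E'] [Algebra E E'] [IsScalarTower k E E'] [Algebra.IsAlgebraic E E'] :
    Algebra.trdeg k E' = Algebra.trdeg k E := by
  rw [← trdeg_add_eq k E (A := E'), trdeg_eq_zero (R := E), add_zero]

/-! ### Essential dimension and subgroups of index prime to `l` -/

namespace GAlgebra

section EssentialDimension

variable {G H : Type*} [Group G] [Group H] {k F : Type u} [Field k] [Field F] [Algebra k F]
  {A : GAlgebra G F}

theorem IsTorsor.essDim_le [Finite G] (hA : A.IsTorsor) (E : IntermediateField k F)
    {A₀ : GAlgebra G E} (hA₀ : A₀.IsTorsor)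
    (h : A₀.ReducesTo (MonoidHom.id G) (algebraMap E F) A) :
    A.essDim k ≤ Cardinal.toENat (Algebra.trdeg k E) :=
  iInf_le_of_le E <| iInf_le_of_le A₀ <| iInf_le_of_le hA₀ <|
    iInf_le_of_le (h.baseChange.iso (hA₀.baseChange F) hA) le_rfl

theorem le_essDim {d : ℕ∞} (h : ∀ (E : IntermediateField k F) (A₀ : GAlgebra G E), A₀.IsTorsor →
    A₀.ReducesTo (MonoidHom.id G) (algebraMap E F) A → d ≤ Cardinal.toENat (Algebra.trdeg k E)) :
    d ≤ A.essDim k :=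
  le_iInf fun E => le_iInf fun A₀ => le_iInf fun hA₀ => le_iInf fun e =>
    h E A₀ hA₀ ((reducesTo_baseChange A₀ F).trans e.reducesTo)

theorem essDimAt_le (A : GAlgebra G F) (K : Type u) [Field K] [Algebra k K] [Algebra F K]
    [IsScalarTower k F K] [FiniteDimensional F K] {l : ℕ} (hl : ¬ l ∣ Module.finrank F K) :
    A.essDimAt k l ≤ (A.baseChange K).essDim k :=
  iInf_le_of_le K <| iInf_le_of_le inferInstance <| iInf_le_of_le inferInstance <|
    iInf_le_of_le inferInstance <| iInf_le_of_le inferInstance <| iInf_le_of_le inferInstance <|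
    iInf_le_of_le hl le_rfl

theorem le_essDimAt {l : ℕ} {d : ℕ∞} (h : ∀ (K : Type u) [Field K] [Algebra k K] [Algebra F K]
    [IsScalarTower k F K] [FiniteDimensional F K], ¬ l ∣ Module.finrank F K →
      d ≤ (A.baseChange K).essDim k) : d ≤ A.essDimAt k l :=
  le_iInf fun K => le_iInf fun _ => le_iInf fun _ => le_iInf fun _ => le_iInf fun _ =>
    le_iInf fun _ => le_iInf fun hK => h K hK

theorem IsTorsor.essDimAt_le_essentialDimensionAt (hA : A.IsTorsor) (l : ℕ) :
    A.essDimAt k l ≤ essentialDimensionAt k G l :=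
  le_iSup_of_le F <| le_iSup_of_le inferInstance <| le_iSup_of_le inferInstance <|
    le_iSup_of_le A <| le_iSup_of_le hA le_rfl

end EssentialDimension

section Descent

variable {G H : Type*} [Group G] [Group H] {φ : H →* G}

theorem IsTorsor.exists_algHom_fixedSubalgebra {E F : Type u} [Field E] [Field F] [Algebra E F]
    {A : GAlgebra G E} {B : GAlgebra H F} (hB : B.IsTorsor) (f : A.carrier →+* B.carrier)
    (hf : ∀ c, f (algebraMap E A.carrier c) = algebraMap F B.carrier (algebraMap E F c))
    (hf' : ∀ h a, f (A.act (φ h) a) = B.act h (f a)) :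
    ∃ ψ : fixedSubalgebra (A.act.comp φ) →ₐ[E] F, ∀ c, algebraMap F B.carrier (ψ c) = f c := by
  have := hB.nontrivial
  have hfix (c : fixedSubalgebra (A.act.comp φ)) : ∃ d : F, algebraMap F B.carrier d = f c := by
    refine Algebra.mem_bot.1 (hB.fixedSubalgebra_eq_bot ▸ mem_fixedSubalgebra.2 fun h => ?_)
    exact (hf' h c).symm.trans (congrArg f (mem_fixedSubalgebra.1 c.2 h))
  choose ψ hψ using hfix
  have hinj := FaithfulSMul.algebraMap_injective F B.carrier
  exact ⟨{  toFun := ψ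
            map_one' := hinj (by simp [hψ])
            map_mul' := fun a b => hinj (by simp [hψ])
            map_zero' := hinj (by simp [hψ])
            map_add' := fun a b => hinj (by simp [hψ])
            commutes' := fun c => hinj ((hψ _).trans (hf c)) }, hψ⟩

variable {k F : Type u} [Field k] [Field F] [Algebra k F] [Finite G] {B : GAlgebra H F}

theorem IsTorsor.essDim_le_of_reducesTo (hB : B.IsTorsor) (hφ : Function.Injective φ)
    (E : IntermediateField k F) {A₀ : GAlgebra G E} (hA₀ : A₀.IsTorsor)
    (h : A₀.ReducesTo φ (algebraMap E F) B) :
    B.essDim k ≤ Cardinal.toENat (Algebra.trdeg k E) := by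
  have := hA₀.finite
  have := Finite.of_injective φ hφ
  obtain ⟨f, hf, hf'⟩ := h
  obtain ⟨ψ, hψ⟩ := hB.exists_algHom_fixedSubalgebra f hf hf'
  let E' : IntermediateField E F := IntermediateField.adjoin E (Set.range ψ)
  have : Algebra.IsAlgebraic E E' := IntermediateField.isAlgebraic_adjoin <| by
    rintro _ ⟨c, rfl⟩
    exact (Algebra.IsIntegral.isIntegral (R := E) c).map ψ
  let : Algebra (fixedSubalgebra (A₀.act.comp φ)) (E'.restrictScalars k) :=
    (RingHom.codRestrict (ψ : fixedSubalgebra (A₀.act.comp φ) →+* F) (E'.restrictScalars k)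
      fun c => IntermediateField.subset_adjoin E _ ⟨c, rfl⟩).toAlgebra
  calc B.essDim k
    _ ≤ Cardinal.toENat (Algebra.trdeg k (E'.restrictScalars k)) :=
      hB.essDim_le _ (hA₀.reduction hφ _) <|
        extendScalars_reducesTo (κ := algebraMap (E'.restrictScalars k) F) f
          (fun c => (hψ c).symm) hf'
    _ = Cardinal.toENat (Algebra.trdeg k E) :=
      congrArg Cardinal.toENat (trdeg_eq_of_isAlgebraic k E E')

end Descent

section PrimeToL

variable {G : Type} {H : Type*} [Group G] [Group H] [Finite G] {φ : H →* G} {k F : Type u}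
  [Field k] [Field F] [Algebra k F] {A : GAlgebra G F}

theorem ReducesTo.essDim_eq {B : GAlgebra H F} (h : A.ReducesTo φ (RingHom.id F) B)
    (hφ : Function.Injective φ) (hA : A.IsTorsor) (hB : B.IsTorsor) :
    A.essDim k = B.essDim k := by
  refine le_antisymm (le_essDim fun E B₀ hB₀ hB₀B => ?_) (le_essDim fun E A₀ hA₀ hA₀A => ?_)
  · have hind : ((GAlgebra.induced φ B₀).baseChange F).Iso A :=
      ((((induced_reducesTo φ B₀).trans hB₀B).baseChange).iso_induced
        ((hB₀.induced hφ).baseChange F) hB hφ).trans (h.iso_induced hA hB hφ).symm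
    exact hA.essDim_le E (hB₀.induced hφ) ((reducesTo_baseChange _ F).trans hind.reducesTo)
  · exact hB.essDim_le_of_reducesTo hφ E hA₀ (hA₀A.trans h)

theorem ReducesTo.essDimAt_le {K : Type u} [Field K] [Algebra k K] [Algebra F K]
    [IsScalarTower k F K] [FiniteDimensional F K] {B : GAlgebra H K}
    (h : A.ReducesTo φ (algebraMap F K) B) (hφ : Function.Injective φ) (hA : A.IsTorsor)
    (hB : B.IsTorsor) {l : ℕ} (hl : l.Prime) (hdeg : ¬ l ∣ Module.finrank F K) :
    A.essDimAt k l ≤ B.essDimAt k l := by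
  have := Finite.of_injective φ hφ
  refine le_essDimAt fun L _ _ _ _ _ hL => ?_
  let : Algebra F L := ((algebraMap K L).comp (algebraMap F K)).toAlgebra
  have : IsScalarTower F K L := IsScalarTower.of_algebraMap_eq fun _ => rfl
  have : IsScalarTower k F L := IsScalarTower.of_algebraMap_eq fun c => by
    rw [IsScalarTower.algebraMap_apply k K L, IsScalarTower.algebraMap_apply k F K]; rfl
  have : FiniteDimensional F L := FiniteDimensional.trans F K L
  have hFL : ¬ l ∣ Module.finrank F L := by
    rw [← Module.finrank_mul_finrank F K L]
    exact hl.not_dvd_mul hdeg hL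
  have hAL : A.ReducesTo φ (algebraMap F L) (B.baseChange L) := h.trans (reducesTo_baseChange B L)
  exact (GAlgebra.essDimAt_le A L hFL).trans_eq
    (hAL.baseChange.essDim_eq hφ (hA.baseChange L) (hB.baseChange L))

theorem IsTorsor.essDimAt_le_essDimAt_induced {B : GAlgebra H F} (hB : B.IsTorsor)
    (hφ : Function.Injective φ) (l : ℕ) :
    B.essDimAt k l ≤ (GAlgebra.induced φ B).essDimAt k l := by
  have := Finite.of_injective φ hφ
  refine le_essDimAt fun L _ _ _ _ _ hL => ?_
  have h : (GAlgebra.induced φ B).ReducesTo φ (algebraMap F L) (B.baseChange L) :=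
    (induced_reducesTo φ B).trans (reducesTo_baseChange B L)
  exact (GAlgebra.essDimAt_le B L hL).trans_eq
    (h.baseChange.essDim_eq hφ ((hB.induced hφ).baseChange L) (hB.baseChange L)).symm

end PrimeToL

end GAlgebra

theorem essentialDimensionAt_eq_of_injective_of_type_zero {G : Type} {H : Type*} [Group G]
    [Group H] [Finite G] (k : Type u) [Field k] {l : ℕ} (hl : l.Prime) {φ : H →* G}
    (hφ : Function.Injective φ) (hindex : ¬ l ∣ φ.range.index) :
    essentialDimensionAt k H l = essentialDimensionAt k G l := by
  apply le_antisymm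
  · refine iSup_le fun F => iSup_le fun _ => iSup_le fun _ => iSup_le fun B => iSup_le fun hB => ?_
    exact (hB.essDimAt_le_essDimAt_induced hφ l).trans
      ((hB.induced hφ).essDimAt_le_essentialDimensionAt l)
  · refine iSup_le fun F => iSup_le fun _ => iSup_le fun _ => iSup_le fun A => iSup_le fun hA => ?_
    obtain ⟨K, _, _, B, _, hdeg, hB, hAB⟩ := hA.exists_reducesTo_not_dvd_finrank hφ hindex
    let : Algebra k K := ((algebraMap F K).comp (algebraMap k F)).toAlgebra
    have : IsScalarTower k F K := IsScalarTower.of_algebraMap_eq fun _ => rfl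
    exact (hAB.essDimAt_le hφ hA hB hl hdeg).trans (hB.essDimAt_le_essentialDimensionAt l)

theorem essentialDimensionAt_eq_of_injective {G H : Type*} [Group G] [Group H] [Finite G]
    (k : Type u) [Field k] {l : ℕ} (hl : l.Prime) {φ : H →* G} (hφ : Function.Injective φ)
    (hindex : ¬ l ∣ φ.range.index) :
    essentialDimensionAt k H l = essentialDimensionAt k G l := by
  let e : G ≃* Shrink.{0} G := Shrink.mulEquiv.symm
  have he : e.toMonoidHom.range.index = 1 := by
    rw [MonoidHom.range_eq_top.2 e.surjective, Subgroup.index_top]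
  rw [essentialDimensionAt_eq_of_injective_of_type_zero k hl (φ := e.toMonoidHom.comp φ)
      (e.injective.comp hφ), essentialDimensionAt_eq_of_injective_of_type_zero k hl
      (φ := e.toMonoidHom) e.injective]
  · rw [he]
    exact hl.not_dvd_one
  · rw [MonoidHom.range_comp]
    exact (φ.range.index_map_of_bijective (f := e.toMonoidHom) e.bijective).symm ▸ hindex

/-! ### Hermitian forms -/

section Hermitian

variable {K V : Type*} [Field K] [AddCommGroup V] [Module K V] {σ : K →+* K}
  {B : V →ₛₗ[σ] V →ₗ[K] K}

theorem exists_apply_self_ne_zero (hB : B.IsSymm) (htr : ∃ c, c + σ c ≠ 0) {u v : V}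
    (huv : B u v ≠ 0) : ∃ a b : K, B (a • u + b • v) (a • u + b • v) ≠ 0 := by
  by_contra! h
  have hu : B u u = 0 := by simpa using h 1 0
  have hv : B v v = 0 := by simpa using h 0 1
  obtain ⟨c, hc⟩ := htr
  have hvu : B v u ≠ 0 := mt hB.eq_iff.2 huv
  have hpolar : B v ((c / B v u) • u) + σ (B v ((c / B v u) • u)) = 0 := by
    rw [hB.eq]
    simpa [hu, hv, add_comm] using h (c / B v u) 1
  rw [map_smul, smul_eq_mul, div_mul_cancel₀ _ hvu] at hpolar
  exact hc hpolar

theorem exists_orthogonal_apply_self_ne_zero [FiniteDimensional K V] (hB : B.IsSymm)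
    (hB' : B.SeparatingLeft) (htr : ∃ c, c + σ c ≠ 0) {m : ℕ} (hm : m < Module.finrank K V)
    {v : Fin m → V} (hv : ∀ i j, B (v i) (v j) = if i = j then 1 else 0) :
    ∃ x, (∀ i, B (v i) x = 0) ∧ B x x ≠ 0 := by
  let L : V →ₗ[K] (Fin m → K) := LinearMap.pi fun i => B (v i)
  have mem_ker_L : ∀ x, x ∈ LinearMap.ker L ↔ ∀ i, B (v i) x = 0 := fun x => funext_iff
  obtain ⟨w, hw, hw0⟩ := (Submodule.ne_bot_iff _).1
    (LinearMap.ker_ne_bot_of_finrank_lt (f := L) (by simpa using hm))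
  obtain ⟨z, hz⟩ : ∃ z, B w z ≠ 0 := by
    by_contra! h
    exact hw0 (hB' w h)
  let z' := z - ∑ i, B (v i) z • v i
  have hz' : z' ∈ LinearMap.ker L := (mem_ker_L _).2 fun i => by simp [z', hv]
  have hwv : ∀ i, B w (v i) = 0 := fun i => hB.eq_iff.1 ((mem_ker_L w).1 hw i)
  have hwz' : B w z' ≠ 0 := by simpa [z', hwv] using hz
  obtain ⟨a, b, hab⟩ := exists_apply_self_ne_zero hB htr hwz'
  exact ⟨_, (mem_ker_L _).1 (add_mem (Submodule.smul_mem _ a hw) (Submodule.smul_mem _ b hz')), hab⟩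

theorem exists_orthonormal_extension [FiniteDimensional K V] (hB : B.IsSymm)
    (hB' : B.SeparatingLeft) (hnorm : ∀ a, σ a = a → a ≠ 0 → ∃ c, c * σ c = a)
    (htr : ∃ c, c + σ c ≠ 0) {m : ℕ} (hm : m < Module.finrank K V) {v : Fin m → V}
    (hv : ∀ i j, B (v i) (v j) = if i = j then 1 else 0) :
    ∃ w, (∀ i, B (v i) w = 0) ∧ B w w = 1 := by
  obtain ⟨x, hvx, hx⟩ := exists_orthogonal_apply_self_ne_zero hB hB' htr hm hv
  obtain ⟨c, hc⟩ := hnorm (B x x)⁻¹ (by rw [map_inv₀, hB.eq]) (inv_ne_zero hx)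
  refine ⟨c • x, fun i => by simp [hvx i], ?_⟩
  calc B (c • x) (c • x) = c * σ c * B x x := by simp; ring
    _ = 1 := by rw [hc, inv_mul_cancel₀ hx]

theorem exists_orthonormal_family [FiniteDimensional K V] (hB : B.IsSymm)
    (hB' : B.SeparatingLeft) (hnorm : ∀ a, σ a = a → a ≠ 0 → ∃ c, c * σ c = a)
    (htr : ∃ c, c + σ c ≠ 0) {m : ℕ} (hm : m ≤ Module.finrank K V) :
    ∃ v : Fin m → V, ∀ i j, B (v i) (v j) = if i = j then 1 else 0 := by
  induction m with
  | zero => exact ⟨Fin.elim0, fun i => i.elim0⟩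
  | succ m ih =>
    obtain ⟨v, hv⟩ := ih (by omega)
    obtain ⟨w, hvw, hw⟩ := exists_orthonormal_extension hB hB' hnorm htr (by omega) hv
    refine ⟨Fin.cons w v, fun i j => ?_⟩
    refine Fin.cases ?_ (fun i => ?_) i <;> refine Fin.cases ?_ (fun j => ?_) j
    · simpa using hw
    · simpa [(Fin.succ_ne_zero j).symm] using hB.eq_iff.1 (hvw j)
    · simpa using hvw i
    · simpa using hv i j

end Hermitian

section HermitianMatrix

open Matrix

variable {K : Type*} [Field K] {n : ℕ} {σ : K →+* K} {β : Matrix (Fin n) (Fin n) K}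

variable (σ β) in
/-- The sesquilinear form of the matrix `β`. It sends `(u, v)` to `vᵀ β σ(u)`, so that the
semilinear argument is the first one, as in `LinearMap.IsSymm`. -/
def sesqForm : (Fin n → K) →ₛₗ[σ] (Fin n → K) →ₗ[K] K :=
  toLinearMapₛₗ₂' K σ (RingHom.id K) βᵀ

theorem sesqForm_apply (u v : Fin n → K) : sesqForm σ β u v = v ⬝ᵥ β *ᵥ (σ ∘ u) := by
  simp only [sesqForm, toLinearMapₛₗ₂'_apply, dotProduct, mulVec, Finset.mul_sum]
  rw [Finset.sum_comm]
  refine Finset.sum_congr rfl fun i _ => Finset.sum_congr rfl fun j _ => ?_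
  simp
  ring

theorem sesqForm_isSymm (hσ : ∀ a, σ (σ a) = a) (hβ : βᵀ = β.map σ) : (sesqForm σ β).IsSymm where
  eq u v := by
    rw [sesqForm_apply, sesqForm_apply, RingHom.map_dotProduct]
    have : σ ∘ (β *ᵥ (σ ∘ u)) = βᵀ *ᵥ u := by
      ext i
      simp [RingHom.map_mulVec, hβ, Function.comp_def, hσ]
    rw [this, mulVec_transpose, dotProduct_comm, dotProduct_mulVec]

theorem sesqForm_separatingLeft (hβ : IsUnit β.det) : (sesqForm σ β).SeparatingLeft := by
  intro u hu
  have hmul : β *ᵥ (σ ∘ u) = 0 := funext fun i => by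
    simpa [sesqForm_apply] using hu (Pi.single i 1)
  have hσu := mulVec_injective_iff_isUnit.2 ((isUnit_iff_isUnit_det β).2 hβ)
    (hmul.trans (mulVec_zero β).symm)
  exact funext fun i => (map_eq_zero σ).1 (congrFun hσu i)

theorem exists_transpose_mul_mul_map_eq_one (hσ : ∀ a, σ (σ a) = a) (hβ : βᵀ = β.map σ)
    (hβ' : IsUnit β.det) (hnorm : ∀ a, σ a = a → a ≠ 0 → ∃ c, c * σ c = a)
    (htr : ∃ c, c + σ c ≠ 0) : ∃ P : GL (Fin n) K, P.valᵀ * β * P.val.map σ = 1 := by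
  obtain ⟨v, hv⟩ := exists_orthonormal_family (sesqForm_isSymm hσ hβ)
    (sesqForm_separatingLeft hβ') hnorm htr (m := n) (by simp)
  let P : Matrix (Fin n) (Fin n) K := of fun i j => v j i
  have hP : Pᵀ * β * P.map σ = 1 := by
    ext i j
    simp only [one_apply, eq_comm (a := i), ← hv, sesqForm_apply, Matrix.mul_assoc]
    rfl
  have hdet : P.det ≠ 0 := fun h => by simpa [h] using congrArg det hP
  exact ⟨GeneralLinearGroup.mkOfDetNeZero P hdet, hP⟩

theorem mem_unitaryGroupOf {M : GL (Fin n) K} :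
    M ∈ unitaryGroupOf σ β ↔ M.valᵀ * β * M.val.map σ = β := Iff.rfl

theorem mem_specialUnitaryGroupOf {M : GL (Fin n) K} :
    M ∈ specialUnitaryGroupOf σ β ↔ M ∈ unitaryGroupOf σ β ∧ M.det = 1 := Iff.rfl

theorem conj_mem_unitaryGroupOf {P : GL (Fin n) K} (hP : P.valᵀ * β * P.val.map σ = 1)
    {M : GL (Fin n) K} (hM : M ∈ unitaryGroupOf σ 1) : P * M * P⁻¹ ∈ unitaryGroupOf σ β := by
  have hM' : M.valᵀ * M.val.map σ = 1 := by simpa [mem_unitaryGroupOf] using hM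
  have hPt : (P⁻¹).valᵀ * P.valᵀ = 1 := by rw [← transpose_mul, ← Units.val_mul]; simp
  have hPσ : P.val.map σ * (P⁻¹).val.map σ = 1 := by rw [← Matrix.map_mul, ← Units.val_mul]; simp
  rw [mem_unitaryGroupOf, Units.val_mul, Units.val_mul, transpose_mul, transpose_mul,
    Matrix.map_mul, Matrix.map_mul]
  calc
    _ = (P⁻¹).valᵀ * (M.valᵀ * (P.valᵀ * β * P.val.map σ) * M.val.map σ) * (P⁻¹).val.map σ := by
      simp only [Matrix.mul_assoc]
    _ = (P⁻¹).valᵀ * (P.valᵀ * β * P.val.map σ) * (P⁻¹).val.map σ := by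
      rw [hP, Matrix.mul_one, hM']
    _ = (P⁻¹).valᵀ * P.valᵀ * β * (P.val.map σ * (P⁻¹).val.map σ) := by
      simp only [Matrix.mul_assoc]
    _ = β := by rw [hPt, hPσ, Matrix.one_mul, Matrix.mul_one]

theorem conj_mem_specialUnitaryGroupOf {P : GL (Fin n) K} (hP : P.valᵀ * β * P.val.map σ = 1)
    {M : GL (Fin n) K} (hM : M ∈ specialUnitaryGroupOf σ 1) :
    P * M * P⁻¹ ∈ specialUnitaryGroupOf σ β := by
  refine ⟨conj_mem_unitaryGroupOf hP hM.1, ?_⟩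
  change GeneralLinearGroup.det (P * M * P⁻¹) = 1
  rw [map_mul, map_mul, (mem_specialUnitaryGroupOf.1 hM).2, map_inv, mul_one, mul_inv_cancel]

end HermitianMatrix

section NormOneUnits

variable {K : Type*} [Field K]

/-- The units of norm one, for the norm `a ↦ a * σ a` attached to an endomorphism `σ`. -/
def normOneUnits (σ : K →+* K) : Subgroup Kˣ :=
  (MonoidHom.id Kˣ * Units.map (σ : K →* K)).ker

variable {σ : K →+* K} {q : ℕ}

theorem mem_normOneUnits {a : Kˣ} : a ∈ normOneUnits σ ↔ (a : K) * σ a = 1 :=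
  MonoidHom.mem_ker.trans Units.ext_iff

theorem neg_one_mem_normOneUnits : (-1 : Kˣ) ∈ normOneUnits σ := by
  simp [mem_normOneUnits]

theorem normOneUnits_eq_ker_powMonoidHom (hσ : ∀ a, σ a = a ^ q) :
    normOneUnits σ = (powMonoidHom (q + 1) : Kˣ →* Kˣ).ker := by
  ext a
  rw [mem_normOneUnits, hσ, ← pow_succ', MonoidHom.mem_ker, powMonoidHom_apply, Units.ext_iff,
    Units.val_pow_eq_pow_val, Units.val_one]

theorem card_units_of_card_eq_sq (hK : Nat.card K = q ^ 2) :
    Nat.card Kˣ = (q - 1) * (q + 1) := by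
  rw [Nat.card_units, hK, mul_comm, ← Nat.sq_sub_sq, one_pow]

variable [Finite K]

theorem one_lt_of_card_eq_sq (hK : Nat.card K = q ^ 2) : 1 < q :=
  (one_lt_sq_iff₀ (Nat.zero_le q)).1 (hK ▸ Finite.one_lt_card)

theorem pow_sub_one_eq_one_iff (hK : Nat.card K = q ^ 2) (hσ : ∀ a, σ a = a ^ q) {a : Kˣ} :
    a ^ (q - 1) = 1 ↔ σ a = a := by
  have hq := one_lt_of_card_eq_sq hK
  rw [← mul_eq_right (b := a), ← pow_succ, Nat.sub_add_cancel hq.le, hσ, Units.ext_iff,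
    Units.val_pow_eq_pow_val]

theorem apply_apply_of_card_eq_sq (hK : Nat.card K = q ^ 2) (hσ : ∀ a, σ a = a ^ q) (a : K) :
    σ (σ a) = a := by
  have := Fintype.ofFinite K
  rw [hσ, hσ, ← pow_mul, ← sq, ← hK, Nat.card_eq_fintype_card, FiniteField.pow_card]

theorem card_ker_powMonoidHom_sub_one (hK : Nat.card K = q ^ 2) :
    Nat.card (powMonoidHom (q - 1) : Kˣ →* Kˣ).ker = q - 1 := by
  rw [IsCyclic.card_powMonoidHom_ker, card_units_of_card_eq_sq hK,
    Nat.gcd_eq_right (Dvd.intro _ rfl)]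

theorem card_normOneUnits (hK : Nat.card K = q ^ 2) (hσ : ∀ a, σ a = a ^ q) :
    Nat.card (normOneUnits σ) = q + 1 := by
  rw [normOneUnits_eq_ker_powMonoidHom hσ, IsCyclic.card_powMonoidHom_ker,
    card_units_of_card_eq_sq hK, Nat.gcd_eq_right (Dvd.intro_left _ rfl)]

theorem range_powMonoidHom_add_one (hK : Nat.card K = q ^ 2) :
    (powMonoidHom (q + 1) : Kˣ →* Kˣ).range = (powMonoidHom (q - 1) : Kˣ →* Kˣ).ker := by
  refine Subgroup.eq_of_le_of_card_ge ?_ ?_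
  · rintro _ ⟨c, rfl⟩
    rw [MonoidHom.mem_ker, powMonoidHom_apply, powMonoidHom_apply, ← pow_mul, mul_comm,
      ← card_units_of_card_eq_sq hK, pow_card_eq_one']
  · rw [card_ker_powMonoidHom_sub_one hK, IsCyclic.card_powMonoidHom_range,
      card_units_of_card_eq_sq hK, Nat.gcd_eq_right (Dvd.intro_left _ rfl),
      Nat.mul_div_cancel _ q.succ_pos]

theorem exists_mul_apply_eq (hK : Nat.card K = q ^ 2) (hσ : ∀ a, σ a = a ^ q) {a : K}
    (ha : σ a = a) (ha0 : a ≠ 0) : ∃ c, c * σ c = a := by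
  have hmem : Units.mk0 a ha0 ∈ (powMonoidHom (q - 1) : Kˣ →* Kˣ).ker :=
    (pow_sub_one_eq_one_iff hK hσ).2 ha
  rw [← range_powMonoidHom_add_one hK] at hmem
  obtain ⟨c, hc⟩ := hmem
  refine ⟨c, ?_⟩
  rw [hσ, ← pow_succ']
  simpa using congrArg Units.val hc

theorem exists_add_apply_ne_zero (hK : Nat.card K = q ^ 2) (hσ : ∀ a, σ a = a ^ q) :
    ∃ c, c + σ c ≠ 0 := by
  by_contra! h
  have hq := one_lt_of_card_eq_sq hK
  have hneg : (-1 : K) = 1 := neg_eq_of_add_eq_zero_right (by simpa using h 1)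
  have hfix : ∀ a, σ a = a := fun a => by
    rw [eq_neg_of_add_eq_zero_right (h a), ← neg_one_mul, hneg, one_mul]
  have hker : (powMonoidHom (q - 1) : Kˣ →* Kˣ).ker = ⊤ :=
    eq_top_iff.2 fun a _ => (pow_sub_one_eq_one_iff hK hσ).2 (hfix a)
  have hcard := card_ker_powMonoidHom_sub_one hK
  rw [hker, Subgroup.card_top, card_units_of_card_eq_sq hK] at hcard
  have := Nat.eq_of_mul_eq_mul_left (by omega) (hcard.trans (mul_one _).symm)
  omega

theorem exists_mem_normOneUnits_ne_inv (hK : Nat.card K = q ^ 2) (hσ : ∀ a, σ a = a ^ q) :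
    ∃ ζ ∈ normOneUnits σ, ζ ≠ ζ⁻¹ := by
  by_contra! h
  have hle : normOneUnits σ ≤ (powMonoidHom 2 : Kˣ →* Kˣ).ker := fun a ha => by
    rw [MonoidHom.mem_ker, powMonoidHom_apply, sq]
    exact mul_eq_one_iff_eq_inv.2 (h a ha)
  have hcard := Subgroup.card_le_of_le hle
  rw [card_normOneUnits hK hσ, IsCyclic.card_powMonoidHom_ker] at hcard
  have hq := one_lt_of_card_eq_sq hK
  have := Nat.gcd_le_right (Nat.card Kˣ) two_pos
  omega

end NormOneUnits

/-! ### Monomial unitary matrices -/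

section Monomial

open Matrix Equiv

variable {ι R : Type*} [Fintype ι] [DecidableEq ι] [CommRing R]

/-- Invertible diagonal matrices, as a homomorphism to the general linear group. -/
def glDiagonal : (ι → Rˣ) →* GL ι R :=
  MonoidHom.toHomUnits
    { toFun := fun d => diagonal fun i => (d i : R)
      map_one' := by simp
      map_mul' := fun d e => by simp [diagonal_mul_diagonal] }

variable (R) in
/-- Permutation matrices, as a homomorphism to the general linear group. -/
def glPerm : Perm ι →* GL ι R :=
  MonoidHom.toHomUnits permMatrixHom

theorem coe_glDiagonal (d : ι → Rˣ) :
    (glDiagonal d : Matrix ι ι R) = diagonal fun i => (d i : R) := rfl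

theorem coe_glPerm (s : Perm ι) : (glPerm R s : Matrix ι ι R) = (s⁻¹).permMatrix R := rfl

theorem glPerm_apply (s : Perm ι) (i j : ι) :
    (glPerm R s : Matrix ι ι R) i j = if i = s j then 1 else 0 := by
  rw [coe_glPerm, Perm.permMatrix, PEquiv.toMatrix_apply]
  simp [Equiv.symm_apply_eq, Perm.inv_def]

theorem glDiagonal_mul_glPerm_apply (d : ι → Rˣ) (s : Perm ι) (i j : ι) :
    (glDiagonal d * glPerm R s).val i j = if i = s j then (d i : R) else 0 := by
  rw [Units.val_mul, coe_glDiagonal, diagonal_mul, glPerm_apply, mul_ite, mul_one, mul_zero]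

theorem glPerm_mul_glDiagonal (s : Perm ι) (d : ι → Rˣ) :
    glPerm R s * glDiagonal d = glDiagonal (fun i => d (s⁻¹ i)) * glPerm R s := by
  ext i j
  rw [glDiagonal_mul_glPerm_apply, Units.val_mul, coe_glDiagonal, mul_diagonal, glPerm_apply]
  by_cases h : i = s j
  · subst h
    simp
  · simp [h]

theorem det_glDiagonal (d : ι → Rˣ) : (glDiagonal d).det = ∏ i, d i := by
  ext
  rw [GeneralLinearGroup.val_det_apply, coe_glDiagonal, det_diagonal]
  simp

theorem val_det_glPerm (s : Perm ι) : (glPerm R s).det.val = (Perm.sign s : ℤ) := by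
  rw [GeneralLinearGroup.val_det_apply, coe_glPerm, det_permutation]
  simp

/-- The monomial matrices with coefficients in a subgroup `U` of the units, as a homomorphism from
the wreath product of `U` with the symmetric group. -/
def glMonomial (U : Subgroup Rˣ) : (ι → U) ⋊[mulAutArrow] Perm ι →* GL ι R :=
  SemidirectProduct.lift
    (glDiagonal.comp (MonoidHom.pi fun i => U.subtype.comp (Pi.evalMonoidHom _ i))) (glPerm R)
    fun s => MonoidHom.ext fun d => by
      change glDiagonal (fun i => (d (s⁻¹ i) : Rˣ)) =
        glPerm R s * glDiagonal (fun i => (d i : Rˣ)) * (glPerm R s)⁻¹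
      rw [glPerm_mul_glDiagonal, mul_inv_cancel_right]

theorem glMonomial_apply (U : Subgroup Rˣ) (x : (ι → U) ⋊[mulAutArrow] Perm ι) :
    glMonomial U x = glDiagonal (fun i => (x.left i : Rˣ)) * glPerm R x.right := rfl

theorem glMonomial_injective [Nontrivial R] (U : Subgroup Rˣ) :
    Function.Injective (glMonomial (ι := ι) U) := by
  rw [injective_iff_map_eq_one]
  rintro ⟨d, s⟩ h
  have entry : ∀ i j, (if i = s j then ((d i : Rˣ) : R) else 0) = if i = j then 1 else 0 :=
    fun i j => by
      rw [← glDiagonal_mul_glPerm_apply (fun i => (d i : Rˣ)) s i j, ← one_apply, ← Units.val_one,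
        ← h]
      rfl
  have hs : s = 1 := Perm.ext fun j => by_contra fun hne =>
    Units.ne_zero _ (((if_pos rfl).symm.trans (entry (s j) j)).trans (if_neg hne))
  subst hs
  have hd : d = 1 := funext fun i => by simpa using entry i i
  rw [hd]
  rfl

end Monomial

section StandardForm

open Matrix

variable {K : Type*} [Field K] {n : ℕ} {σ : K →+* K}

theorem glDiagonal_mem_unitaryGroupOf {d : Fin n → Kˣ} (hd : ∀ i, d i ∈ normOneUnits σ) :
    glDiagonal d ∈ unitaryGroupOf σ 1 := by
  rw [mem_unitaryGroupOf, coe_glDiagonal, diagonal_transpose, Matrix.mul_one,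
    diagonal_map (map_zero σ), diagonal_mul_diagonal, ← diagonal_one]
  exact congrArg diagonal (funext fun i => mem_normOneUnits.1 (hd i))

theorem glPerm_mem_unitaryGroupOf (s : Equiv.Perm (Fin n)) : glPerm K s ∈ unitaryGroupOf σ 1 := by
  have hmap : (glPerm K s).val.map σ = glPerm K s := by
    ext i j
    rw [map_apply, glPerm_apply, apply_ite σ, map_one, map_zero]
  rw [mem_unitaryGroupOf, hmap, Matrix.mul_one, coe_glPerm, transpose_permMatrix, inv_inv,
    ← permMatrix_mul, inv_mul_cancel, permMatrix_one]

theorem glDiagonal_mem_specialUnitaryGroupOf {ζ : Kˣ} (hζ : ζ ∈ normOneUnits σ) (i j : Fin n) :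
    glDiagonal (Pi.mulSingle i ζ * Pi.mulSingle j ζ⁻¹) ∈ specialUnitaryGroupOf σ 1 := by
  refine ⟨glDiagonal_mem_unitaryGroupOf fun a => mul_mem ?_ ?_, ?_⟩
  · rw [Pi.mulSingle_apply]
    split_ifs
    exacts [hζ, one_mem _]
  · rw [Pi.mulSingle_apply]
    split_ifs
    exacts [inv_mem hζ, one_mem _]
  · change GeneralLinearGroup.det _ = 1
    simp [det_glDiagonal]

theorem glDiagonal_mul_glPerm_swap_mem_specialUnitaryGroupOf {i j : Fin n} (hij : i ≠ j) :
    glDiagonal (Pi.mulSingle i (-1)) * glPerm K (Equiv.swap i j) ∈ specialUnitaryGroupOf σ 1 := by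
  refine ⟨mul_mem (glDiagonal_mem_unitaryGroupOf fun a => ?_) (glPerm_mem_unitaryGroupOf _), ?_⟩
  · rw [Pi.mulSingle_apply]
    split_ifs
    exacts [neg_one_mem_normOneUnits, one_mem _]
  · change GeneralLinearGroup.det _ = 1
    ext
    rw [map_mul, Units.val_mul, val_det_glPerm, det_glDiagonal, Equiv.Perm.sign_swap hij]
    simp

section Commutant

variable {M : Matrix (Fin n) (Fin n) K}

theorem apply_eq_zero_of_commute_specialUnitaryGroupOf_one
    (hζ : ∃ ζ ∈ normOneUnits σ, ζ ≠ ζ⁻¹) (hM : ∀ N ∈ specialUnitaryGroupOf σ 1, Commute M N.val)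
    {i j : Fin n} (hij : i ≠ j) : M i j = 0 := by
  obtain ⟨ζ, hζ, hζ'⟩ := hζ
  have h := congrFun₂ (hM _ (glDiagonal_mem_specialUnitaryGroupOf hζ i j)).eq i j
  rw [coe_glDiagonal, mul_diagonal, diagonal_mul, mul_comm] at h
  by_contra hne
  have := mul_right_cancel₀ hne h
  exact hζ' (Units.ext (by simpa [hij, hij.symm] using this.symm))

theorem apply_self_eq_of_commute_specialUnitaryGroupOf_one
    (hζ : ∃ ζ ∈ normOneUnits σ, ζ ≠ ζ⁻¹) (hM : ∀ N ∈ specialUnitaryGroupOf σ 1, Commute M N.val)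
    (i j : Fin n) : M i i = M j j := by
  rcases eq_or_ne i j with rfl | hij
  · rfl
  have hoff : ∀ {a b}, a ≠ b → M a b = 0 :=
    apply_eq_zero_of_commute_specialUnitaryGroupOf_one hζ hM
  have h := congrFun₂ (hM _ (glDiagonal_mul_glPerm_swap_mem_specialUnitaryGroupOf hij)).eq i j
  rw [mul_apply, mul_apply,
    Finset.sum_eq_single i (fun b _ hb => by rw [hoff hb.symm, zero_mul]) (by simp),
    Finset.sum_eq_single j (fun b _ hb => by rw [hoff hb, mul_zero]) (by simp),
    glDiagonal_mul_glPerm_apply] at h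
  simpa using h

theorem mem_range_scalar_of_commute_specialUnitaryGroupOf_one
    (hζ : ∃ ζ ∈ normOneUnits σ, ζ ≠ ζ⁻¹) (hM : ∀ N ∈ specialUnitaryGroupOf σ 1, Commute M N.val) :
    M ∈ Set.range (scalar (Fin n)) := by
  rcases isEmpty_or_nonempty (Fin n) with _ | ⟨⟨i⟩⟩
  · exact ⟨0, Subsingleton.elim _ _⟩
  refine ⟨M i i, ?_⟩
  ext a b
  rcases eq_or_ne a b with rfl | hab
  · simpa using apply_self_eq_of_commute_specialUnitaryGroupOf_one hζ hM i a
  · rw [apply_eq_zero_of_commute_specialUnitaryGroupOf_one hζ hM hab, scalar_apply,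
      diagonal_apply_ne _ hab]

end Commutant

theorem mem_center_of_commute_specialUnitaryGroupOf (hζ : ∃ ζ ∈ normOneUnits σ, ζ ≠ ζ⁻¹)
    {β : Matrix (Fin n) (Fin n) K} (hβ : ∃ P : GL (Fin n) K, P.valᵀ * β * P.val.map σ = 1)
    {M : GL (Fin n) K} (hM : ∀ N ∈ specialUnitaryGroupOf σ β, Commute M N) :
    M ∈ Subgroup.center (GL (Fin n) K) := by
  obtain ⟨P, hP⟩ := hβ
  have hconj : P⁻¹ * M * P ∈ Subgroup.center (GL (Fin n) K) := by
    refine GeneralLinearGroup.mem_center_iff_val_mem_range_scalar.2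
      (mem_range_scalar_of_commute_specialUnitaryGroupOf_one hζ fun N hN => Commute.units_val ?_)
    have h := (hM _ (conj_mem_specialUnitaryGroupOf hP hN)).eq
    calc P⁻¹ * M * P * N = P⁻¹ * (M * (P * N * P⁻¹)) * P := by group
      _ = P⁻¹ * ((P * N * P⁻¹) * M) * P := by rw [h]
      _ = N * (P⁻¹ * M * P) := by group
  have hM' : M = P * (P⁻¹ * M * P) * P⁻¹ := by group
  exact hM' ▸ Subgroup.Normal.conj_mem inferInstance _ hconj P

end StandardForm

/-! ### Group orders -/

section UnitaryOrder

open Matrix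

variable {K : Type*} [Field K] {n q : ℕ} {σ : K →+* K} {β : Matrix (Fin n) (Fin n) K}

theorem card_normOneUnits_pow_mul_factorial_dvd :
    Nat.card (normOneUnits σ) ^ n * n.factorial ∣
      Nat.card (unitaryGroupOf σ (1 : Matrix (Fin n) (Fin n) K)) := by
  have hmem : ∀ x, glMonomial (ι := Fin n) (normOneUnits σ) x ∈ unitaryGroupOf σ 1 := fun x => by
    rw [glMonomial_apply]
    exact mul_mem (glDiagonal_mem_unitaryGroupOf fun i => (x.left i).2)
      (glPerm_mem_unitaryGroupOf _)
  have hdvd := Subgroup.card_dvd_of_injective ((glMonomial (ι := Fin n) _).codRestrict _ hmem)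
    ((MonoidHom.injective_codRestrict _ _ _).2 (glMonomial_injective _))
  rwa [SemidirectProduct.card, Nat.card_fun, Nat.card_fin, Nat.card_perm, Nat.card_fin] at hdvd

theorem card_unitaryGroupOf_one_dvd {P : GL (Fin n) K} (hP : P.valᵀ * β * P.val.map σ = 1) :
    Nat.card (unitaryGroupOf σ (1 : Matrix (Fin n) (Fin n) K)) ∣ Nat.card (unitaryGroupOf σ β) :=
  Subgroup.card_dvd_of_injective
    (((MulAut.conj P).toMonoidHom.comp (unitaryGroupOf σ 1).subtype).codRestrict _
      fun M => conj_mem_unitaryGroupOf hP M.2)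
    ((MonoidHom.injective_codRestrict _ _ _).2
      ((MulAut.conj P).injective.comp Subtype.val_injective))

theorem det_mem_normOneUnits (hβ : IsUnit β.det) {M : GL (Fin n) K} (hM : M ∈ unitaryGroupOf σ β) :
    M.det ∈ normOneUnits σ := by
  have hdet := congrArg det (mem_unitaryGroupOf.1 hM)
  rw [det_mul, det_mul, det_transpose, ← RingHom.mapMatrix_apply, ← RingHom.map_det] at hdet
  refine mem_normOneUnits.2 (mul_right_cancel₀ hβ.ne_zero ?_)
  rw [GeneralLinearGroup.val_det_apply]
  linear_combination hdet

theorem card_unitaryGroupOf_dvd (hβ : IsUnit β.det) :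
    Nat.card (unitaryGroupOf σ β) ∣
      Nat.card (specialUnitaryGroupOf σ β) * Nat.card (normOneUnits σ) := by
  let δ : unitaryGroupOf σ β →* Kˣ := GeneralLinearGroup.det.comp (unitaryGroupOf σ β).subtype
  rw [← Subgroup.card_mul_index δ.ker, Subgroup.index_ker]
  apply mul_dvd_mul
  · exact Subgroup.card_dvd_of_injective
      (((unitaryGroupOf σ β).subtype.comp δ.ker.subtype).codRestrict (specialUnitaryGroupOf σ β)
        fun M => ⟨M.1.2, M.2⟩)
      ((MonoidHom.injective_codRestrict _ _ _).2
        (Subtype.val_injective.comp Subtype.val_injective))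
  · refine Subgroup.card_dvd_of_le ?_
    rintro _ ⟨M, rfl⟩
    exact det_mem_normOneUnits hβ M.2

theorem card_specialLinearGroup_mul_card_units_dvd {ι R : Type*} [Fintype ι] [DecidableEq ι]
    [Nonempty ι] [CommRing R] :
    Nat.card (SpecialLinearGroup ι R) * Nat.card Rˣ ∣ Nat.card (GL ι R) := by
  rw [← Subgroup.card_mul_index (GeneralLinearGroup.det : GL ι R →* Rˣ).ker, Subgroup.index_ker,
    MonoidHom.range_eq_top.2 GeneralLinearGroup.det_surjective, Subgroup.card_top]
  refine mul_dvd_mul_right (Subgroup.card_dvd_of_injective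
    (SpecialLinearGroup.toGL.codRestrict (GeneralLinearGroup.det : GL ι R →* Rˣ).ker fun M => ?_)
    ((MonoidHom.injective_codRestrict _ _ _).2 SpecialLinearGroup.toGL_injective)) _
  exact Units.ext (by simp)

end UnitaryOrder

section Valuation

variable {l : ℕ} [hl : Fact l.Prime]

theorem padicValNat_le_of_dvd {a b : ℕ} (hab : a ∣ b) (hb : b ≠ 0) :
    padicValNat l a ≤ padicValNat l b :=
  (padicValNat_dvd_iff_le hb).1 (pow_padicValNat_dvd.trans hab)

theorem padicValNat_sq_sub_one (hl2 : l ≠ 2) {q : ℕ} (hq : 1 < q) (hlq : l ∣ q + 1) :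
    padicValNat l (q ^ 2 - 1) = padicValNat l (q + 1) := by
  have hfactor : q ^ 2 - 1 = (q + 1) * (q - 1) := by rw [← Nat.sq_sub_sq, one_pow]
  have hndvd : ¬ l ∣ q - 1 := fun h => by
    have h2 : l ∣ q + 1 - (q - 1) := Nat.dvd_sub hlq h
    rw [show q + 1 - (q - 1) = 2 by omega] at h2
    exact hl2 ((Nat.prime_dvd_prime_iff_eq hl.out Nat.prime_two).1 h2)
  rw [hfactor, padicValNat.mul (by omega) (by omega), padicValNat.eq_zero_of_not_dvd hndvd,
    add_zero]

theorem prod_pow_sub_pow_succ (Q n : ℕ) :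
    ∏ i ∈ Finset.range (n + 1), (Q ^ (n + 1) - Q ^ i) =
      Q ^ n * (∏ i ∈ Finset.range n, (Q ^ n - Q ^ i)) * (Q ^ (n + 1) - 1) := by
  have hfactor : ∀ i, Q ^ (n + 1) - Q ^ (i + 1) = Q * (Q ^ n - Q ^ i) := fun i => by
    rw [Nat.mul_sub, ← pow_succ', ← pow_succ']
  rw [Finset.prod_range_succ', pow_zero, Finset.prod_congr rfl fun i _ => hfactor i,
    Finset.prod_mul_distrib, Finset.prod_const, Finset.card_range]

theorem prod_pow_sub_pow_ne_zero {Q : ℕ} (hQ : 1 < Q) (n : ℕ) :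
    ∏ i ∈ Finset.range n, (Q ^ n - Q ^ i) ≠ 0 :=
  Finset.prod_ne_zero_iff.2 fun _ hi =>
    Nat.sub_ne_zero_of_lt (Nat.pow_lt_pow_right hQ (Finset.mem_range.1 hi))

theorem padicValNat_prod_pow_sub_pow (hl2 : l ≠ 2) {Q : ℕ} (hQ : 1 < Q) (hlQ : l ∣ Q - 1) (n : ℕ) :
    padicValNat l (∏ i ∈ Finset.range n, (Q ^ n - Q ^ i)) =
      n * padicValNat l (Q - 1) + padicValNat l n.factorial := by
  have hndvd : ¬ l ∣ Q := fun h =>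
    hl.out.one_lt.ne' (Nat.dvd_one.1 (by simpa [Nat.sub_sub_self hQ.le] using Nat.dvd_sub h hlQ))
  induction n with
  | zero => simp
  | succ n ih =>
    have hQn : Q ^ n ≠ 0 := pow_ne_zero _ (by omega)
    have hprod := prod_pow_sub_pow_ne_zero hQ n
    have hlast : Q ^ (n + 1) - 1 ≠ 0 :=
      Nat.sub_ne_zero_of_lt (Nat.one_lt_pow n.succ_ne_zero hQ)
    have hlte : padicValNat l (Q ^ (n + 1) - 1) =
        padicValNat l (Q - 1) + padicValNat l (n + 1) := by
      simpa using padicValNat.pow_sub_pow (hl.out.odd_of_ne_two hl2) hQ hlQ hndvd n.succ_ne_zero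
    rw [prod_pow_sub_pow_succ, padicValNat.mul (mul_ne_zero hQn hprod) hlast,
      padicValNat.mul hQn hprod, ih, hlte,
      padicValNat.eq_zero_of_not_dvd (fun h => hndvd (hl.out.dvd_of_dvd_pow h)),
      Nat.factorial_succ, padicValNat.mul n.succ_ne_zero n.factorial_ne_zero]
    ring

open Matrix

variable {K : Type*} [Field K] [Finite K] {n q : ℕ}

theorem padicValNat_card_specialLinearGroup_add_le [NeZero n] (hK : Nat.card K = q ^ 2)
    (hl2 : l ≠ 2) (hlq : l ∣ q + 1) :
    padicValNat l (Nat.card (SpecialLinearGroup (Fin n) K)) + padicValNat l (q + 1) ≤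
      n * padicValNat l (q + 1) + padicValNat l n.factorial := by
  have := Fintype.ofFinite K
  have hq := one_lt_of_card_eq_sq hK
  have hQ : 1 < q ^ 2 := Nat.one_lt_pow two_ne_zero hq
  have hlQ : l ∣ q ^ 2 - 1 := hlq.trans ⟨q - 1, by rw [← Nat.sq_sub_sq, one_pow]⟩
  have hcard : Nat.card (GL (Fin n) K) = ∏ i ∈ Finset.range n, ((q ^ 2) ^ n - (q ^ 2) ^ i) := by
    rw [card_GL_field, ← Nat.card_eq_fintype_card, hK,
      Fin.prod_univ_eq_prod_range (fun i => (q ^ 2) ^ n - (q ^ 2) ^ i)]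
  have hle := padicValNat_le_of_dvd (l := l)
    (card_specialLinearGroup_mul_card_units_dvd (ι := Fin n) (R := K)) Nat.card_pos.ne'
  rwa [padicValNat.mul Nat.card_pos.ne' Nat.card_pos.ne', hcard,
    padicValNat_prod_pow_sub_pow hl2 hQ hlQ, Nat.card_units, hK,
    padicValNat_sq_sub_one hl2 hq hlq] at hle

variable {σ : K →+* K} {β : Matrix (Fin n) (Fin n) K}

theorem exists_transpose_mul_mul_map_eq_one_of_card_eq_sq (hK : Nat.card K = q ^ 2)
    (hσ : ∀ a, σ a = a ^ q) (hβ : βᵀ = β.map σ) (hβ' : IsUnit β.det) :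
    ∃ P : GL (Fin n) K, P.valᵀ * β * P.val.map σ = 1 :=
  exists_transpose_mul_mul_map_eq_one (apply_apply_of_card_eq_sq hK hσ) hβ hβ'
    (fun _ => exists_mul_apply_eq hK hσ) (exists_add_apply_ne_zero hK hσ)

theorem le_padicValNat_card_specialUnitaryGroupOf_add (hK : Nat.card K = q ^ 2)
    (hσ : ∀ a, σ a = a ^ q) (hβ : βᵀ = β.map σ) (hβ' : IsUnit β.det) :
    n * padicValNat l (q + 1) + padicValNat l n.factorial ≤
      padicValNat l (Nat.card (specialUnitaryGroupOf σ β)) + padicValNat l (q + 1) := by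
  obtain ⟨P, hP⟩ := exists_transpose_mul_mul_map_eq_one_of_card_eq_sq hK hσ hβ hβ'
  have hdvd := (card_normOneUnits_pow_mul_factorial_dvd (σ := σ) (n := n)).trans
    ((card_unitaryGroupOf_one_dvd hP).trans (card_unitaryGroupOf_dvd hβ'))
  rw [card_normOneUnits hK hσ] at hdvd
  have hle := padicValNat_le_of_dvd (l := l) hdvd (mul_ne_zero Nat.card_pos.ne' q.succ_ne_zero)
  rwa [padicValNat.mul (by positivity) n.factorial_ne_zero, padicValNat.pow,
    padicValNat.mul Nat.card_pos.ne' q.succ_ne_zero] at hle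

theorem padicValNat_card_specialLinearGroup_le (hK : Nat.card K = q ^ 2)
    (hσ : ∀ a, σ a = a ^ q) (hβ : βᵀ = β.map σ) (hβ' : IsUnit β.det) (hl2 : l ≠ 2)
    (hlq : l ∣ q + 1) :
    padicValNat l (Nat.card (SpecialLinearGroup (Fin n) K)) ≤
      padicValNat l (Nat.card (specialUnitaryGroupOf σ β)) := by
  rcases eq_zero_or_neZero n with rfl | _
  · simp
  · exact Nat.le_of_add_le_add_right
      ((padicValNat_card_specialLinearGroup_add_le hK hl2 hlq).trans
        (le_padicValNat_card_specialUnitaryGroupOf_add hK hσ hβ hβ'))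

end Valuation

section GroupTheory

variable {S T : Type*} [Group S] [Group T]

/-- The map of central quotients induced by a homomorphism under which the centers correspond. -/
def centerQuotientMap (f : S →* T) (hf : (Subgroup.center T).comap f = Subgroup.center S) :
    S ⧸ Subgroup.center S →* T ⧸ Subgroup.center T :=
  QuotientGroup.map _ _ f hf.ge

theorem centerQuotientMap_injective (f : S →* T)
    (hf : (Subgroup.center T).comap f = Subgroup.center S) :
    Function.Injective (centerQuotientMap f hf) := by
  rw [← MonoidHom.ker_eq_bot_iff, centerQuotientMap, QuotientGroup.ker_map, hf,
    QuotientGroup.map_mk'_self]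

theorem not_dvd_index_range_centerQuotientMap [Finite T] {l : ℕ} [Fact l.Prime] {f : S →* T}
    (hinj : Function.Injective f) (hf : (Subgroup.center T).comap f = Subgroup.center S)
    (hle : padicValNat l (Nat.card T) ≤ padicValNat l (Nat.card S)) :
    ¬ l ∣ (centerQuotientMap f hf).range.index := by
  have := Finite.of_injective f hinj
  have hcenter : padicValNat l (Nat.card (Subgroup.center S)) ≤
      padicValNat l (Nat.card (Subgroup.center T)) :=
    padicValNat_le_of_dvd (Subgroup.card_dvd_of_injective
      ((f.comp (Subgroup.center S).subtype).codRestrict (Subgroup.center T) fun z => hf.ge z.2)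
      ((MonoidHom.injective_codRestrict _ _ _).2 (hinj.comp Subtype.val_injective)))
      Nat.card_pos.ne'
  have hindex : Nat.card (T ⧸ Subgroup.center T) =
      Nat.card (S ⧸ Subgroup.center S) * (centerQuotientMap f hf).range.index := by
    rw [← Subgroup.card_mul_index (centerQuotientMap f hf).range,
      Nat.card_congr (MonoidHom.ofInjective (centerQuotientMap_injective f hf)).toEquiv]
  rw [Subgroup.card_eq_card_quotient_mul_card_subgroup (Subgroup.center T),
    Subgroup.card_eq_card_quotient_mul_card_subgroup (Subgroup.center S),
    padicValNat.mul Nat.card_pos.ne' Nat.card_pos.ne',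
    padicValNat.mul Nat.card_pos.ne' Nat.card_pos.ne', hindex,
    padicValNat.mul Nat.card_pos.ne' Subgroup.index_ne_zero_of_finite] at hle
  rw [dvd_iff_padicValNat_ne_zero Subgroup.index_ne_zero_of_finite, not_not]
  omega

theorem nonempty_sylow_mulEquiv_of_injective [Finite T] {l : ℕ} [Fact l.Prime] {f : S →* T}
    (hinj : Function.Injective f) (hindex : ¬ l ∣ f.range.index) (P : Sylow l S) (Q : Sylow l T) :
    Nonempty (P ≃* Q) := by
  have := Finite.of_injective f hinj
  have hP : IsPGroup l ((P : Subgroup S).map f) := P.isPGroup'.map f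
  have hmap : ¬ l ∣ ((P : Subgroup S).map f).index := by
    rw [Subgroup.index_map, (MonoidHom.ker_eq_bot_iff f).2 hinj, sup_bot_eq,
      (Fact.out : l.Prime).dvd_mul, not_or]
    exact ⟨P.not_dvd_index, hindex⟩
  exact ⟨((P : Subgroup S).equivMapOfInjective f hinj).trans ((hP.toSylow hmap).equiv Q)⟩

theorem essentialDimensionAt_quotient_eq [Finite S] (k : Type u) [Field k] {l : ℕ}
    (hl : l.Prime) (N : Subgroup S) [N.Normal] (hN : ¬ l ∣ Nat.card N) :
    essentialDimensionAt k (S ⧸ N) l = essentialDimensionAt k S l := by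
  have := Fact.mk hl
  obtain ⟨P⟩ : Nonempty (Sylow l S) := inferInstance
  let π : P →* S ⧸ N := (QuotientGroup.mk' N).comp (P : Subgroup S).subtype
  have hinj : Function.Injective π := by
    have hcoprime : (Nat.card P).Coprime (Nat.card N) := by
      obtain ⟨m, hm⟩ := IsPGroup.iff_card.1 P.isPGroup'
      exact hm ▸ ((Nat.Prime.coprime_iff_not_dvd hl).2 hN).pow_left m
    rw [← MonoidHom.ker_eq_bot_iff, ← MonoidHom.comap_ker, QuotientGroup.ker_mk',
      ← Subgroup.subgroupOf, Subgroup.subgroupOf_eq_bot]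
    exact (Subgroup.disjoint_of_coprime_natCard hcoprime).symm
  have hindex : ¬ l ∣ π.range.index := by
    rw [MonoidHom.range_comp, Subgroup.range_subtype, Subgroup.index_map,
      MonoidHom.range_eq_top.2 (QuotientGroup.mk'_surjective N), Subgroup.index_top, mul_one]
    exact fun h => P.not_dvd_index (h.trans (Subgroup.index_dvd_of_le le_sup_left))
  rw [← essentialDimensionAt_eq_of_injective k hl hinj hindex,
    essentialDimensionAt_eq_of_injective k hl (P : Subgroup S).subtype_injective]
  rw [Subgroup.range_subtype]
  exact P.not_dvd_index

end GroupTheory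

/-! ### The center of the special unitary group -/

section Center

open Matrix

variable {K : Type*} [Field K] {n q : ℕ} {σ : K →+* K} {β : Matrix (Fin n) (Fin n) K}

theorem mem_normOneUnits_of_scalar_mem_unitaryGroupOf (hβ : β ≠ 0) {c : Kˣ}
    (hc : GeneralLinearGroup.scalar (Fin n) c ∈ unitaryGroupOf σ β) : c ∈ normOneUnits σ := by
  obtain ⟨i, j, hij⟩ : ∃ i j, β i j ≠ 0 := by
    by_contra! h
    exact hβ (Matrix.ext h)
  have h := congrFun₂ (mem_unitaryGroupOf.1 hc) i j
  rw [GeneralLinearGroup.coe_scalar, scalar_apply, diagonal_transpose,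
    diagonal_map (map_zero σ), mul_diagonal, diagonal_mul] at h
  refine mem_normOneUnits.2 (mul_right_cancel₀ hij ?_)
  linear_combination h

/-- The inclusion of the special unitary group in the special linear group. -/
def specialUnitaryToSL (σ : K →+* K) (β : Matrix (Fin n) (Fin n) K) :
    specialUnitaryGroupOf σ β →* SpecialLinearGroup (Fin n) K where
  toFun z := ⟨z.1, by
    rw [← GeneralLinearGroup.val_det_apply, (mem_specialUnitaryGroupOf.1 z.2).2, Units.val_one]⟩
  map_one' := rfl
  map_mul' _ _ := rfl

theorem toGL_specialUnitaryToSL (z : specialUnitaryGroupOf σ β) :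
    (specialUnitaryToSL σ β z).toGL = z := Units.ext rfl

theorem specialUnitaryToSL_injective : Function.Injective (specialUnitaryToSL σ β) := fun _ _ h =>
  Subtype.ext (Units.ext (congrArg Subtype.val h))

variable [Finite K]

theorem val_mem_center_of_mem_center (hK : Nat.card K = q ^ 2) (hσ : ∀ a, σ a = a ^ q)
    (hβ : βᵀ = β.map σ) (hβ' : IsUnit β.det) {z : specialUnitaryGroupOf σ β}
    (hz : z ∈ Subgroup.center (specialUnitaryGroupOf σ β)) :
    z.1 ∈ Subgroup.center (GL (Fin n) K) :=
  mem_center_of_commute_specialUnitaryGroupOf (exists_mem_normOneUnits_ne_inv hK hσ)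
    (exists_transpose_mul_mul_map_eq_one_of_card_eq_sq hK hσ hβ hβ')
    fun N hN => (congrArg Subtype.val (Subgroup.mem_center_iff.1 hz ⟨N, hN⟩)).symm

theorem comap_center_specialUnitaryToSL (hK : Nat.card K = q ^ 2) (hσ : ∀ a, σ a = a ^ q)
    (hβ : βᵀ = β.map σ) (hβ' : IsUnit β.det) :
    (Subgroup.center (SpecialLinearGroup (Fin n) K)).comap (specialUnitaryToSL σ β) =
      Subgroup.center (specialUnitaryGroupOf σ β) := by
  ext z
  rw [Subgroup.mem_comap]
  constructor <;> intro hz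
  · refine Subgroup.mem_center_iff.2 fun g => specialUnitaryToSL_injective ?_
    rw [map_mul, map_mul]
    exact Subgroup.mem_center_iff.1 hz _
  · rw [← SpecialLinearGroup.toGL_mem_center_iff, toGL_specialUnitaryToSL]
    exact val_mem_center_of_mem_center hK hσ hβ hβ' hz

theorem pow_eq_one_of_mem_center_specialUnitaryGroupOf (hK : Nat.card K = q ^ 2)
    (hσ : ∀ a, σ a = a ^ q) (hβ : βᵀ = β.map σ) (hβ' : IsUnit β.det)
    {z : specialUnitaryGroupOf σ β} (hz : z ∈ Subgroup.center (specialUnitaryGroupOf σ β)) :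
    z ^ n = 1 ∧ z ^ (q + 1) = 1 := by
  rcases eq_zero_or_neZero n with rfl | _
  · exact ⟨pow_zero z, Subsingleton.elim _ _⟩
  have hcenter := val_mem_center_of_mem_center hK hσ hβ hβ' hz
  rw [GeneralLinearGroup.center_eq_range_scalar] at hcenter
  obtain ⟨c, hc⟩ := hcenter
  have hpow : ∀ m, c ^ m = 1 → z ^ m = 1 := fun m hm => Subtype.ext <| by
    rw [SubgroupClass.coe_pow, ← hc, ← map_pow, hm, map_one, OneMemClass.coe_one]
  refine ⟨hpow _ ?_, hpow _ ?_⟩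
  · have hdet := (mem_specialUnitaryGroupOf.1 z.2).2
    rwa [← hc, GeneralLinearGroup.det_scalar, Fintype.card_fin] at hdet
  · have hβ0 : β ≠ 0 := fun h => hβ'.ne_zero (by rw [h, det_zero])
    have hmem := mem_normOneUnits_of_scalar_mem_unitaryGroupOf hβ0 (hc ▸ z.2.1)
    rw [← card_normOneUnits hK hσ]
    exact congrArg Subtype.val (pow_card_eq_one' (x := (⟨c, hmem⟩ : normOneUnits σ)))

theorem dvd_of_dvd_card_center_specialUnitaryGroupOf (hK : Nat.card K = q ^ 2)
    (hσ : ∀ a, σ a = a ^ q) (hβ : βᵀ = β.map σ) (hβ' : IsUnit β.det) {l : ℕ} (hl : l.Prime)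
    (h : l ∣ Nat.card (Subgroup.center (specialUnitaryGroupOf σ β))) : l ∣ n ∧ l ∣ q + 1 := by
  have := Fact.mk hl
  obtain ⟨⟨z, hz⟩, hord⟩ := exists_prime_orderOf_dvd_card' l h
  rw [Subgroup.orderOf_mk] at hord
  exact hord ▸ (pow_eq_one_of_mem_center_specialUnitaryGroupOf hK hσ hβ hβ' hz).imp
    orderOf_dvd_of_pow_eq_one orderOf_dvd_of_pow_eq_one

end Center

theorem theorem11p1_general {K : Type*} [Field K] [Finite K] {q : ℕ} (hK : Nat.card K = q ^ 2)
    {σ : K →+* K} (hσ : ∀ a, σ a = a ^ q) {n : ℕ} {β : Matrix (Fin n) (Fin n) K}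
    (hβ : β.transpose = β.map σ) (hβ' : IsUnit β.det) {l : ℕ} (hl : l.Prime)
    (k : Type u) [Field k] :
    (¬ l ∣ n ∨ ¬ l ∣ q + 1 →
      essentialDimensionAt k
          (specialUnitaryGroupOf σ β ⧸ Subgroup.center (specialUnitaryGroupOf σ β)) l =
        essentialDimensionAt k (specialUnitaryGroupOf σ β) l) ∧
    (l ≠ 2 ∧ l ∣ q + 1 →
      essentialDimensionAt k
          (specialUnitaryGroupOf σ β ⧸ Subgroup.center (specialUnitaryGroupOf σ β)) l =
        essentialDimensionAt k (Matrix.ProjectiveSpecialLinearGroup (Fin n) K) l ∧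
      ∀ (P : Sylow l (specialUnitaryGroupOf σ β ⧸ Subgroup.center (specialUnitaryGroupOf σ β)))
        (Q : Sylow l (Matrix.ProjectiveSpecialLinearGroup (Fin n) K)), Nonempty (P ≃* Q)) := by
  have := Fact.mk hl
  refine ⟨fun h => essentialDimensionAt_quotient_eq k hl _ fun hdvd => ?_, fun ⟨hl2, hlq⟩ => ?_⟩
  · exact not_and_or.2 h (dvd_of_dvd_card_center_specialUnitaryGroupOf hK hσ hβ hβ' hl hdvd)
  · have hcenter := comap_center_specialUnitaryToSL hK hσ hβ hβ'
    have hinj := centerQuotientMap_injective _ hcenter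
    have hindex := not_dvd_index_range_centerQuotientMap specialUnitaryToSL_injective hcenter
      (padicValNat_card_specialLinearGroup_le hK hσ hβ hβ' hl2 hlq)
    exact ⟨essentialDimensionAt_eq_of_injective k hl hinj hindex,
      nonempty_sylow_mulEquiv_of_injective hinj hindex⟩

theorem conjFq_apply (p : ℕ) [Fact p.Prime] (r : ℕ) (a : GaloisField p (2 * r)) :
    conjFq p r a = a ^ p ^ r :=
  iterateFrobenius_def p r a

theorem theorem11p1 (p : ℕ) [Fact p.Prime] (r : ℕ) (hr : 0 < r) (n : ℕ)
    (l : ℕ) (hl : l.Prime) (hl2 : l ≠ 2) (hlp : l ≠ p)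
    (k : Type u) [Field k] (hk : ringChar k ≠ l)
    (β : Matrix (Fin n) (Fin n) (GaloisField p (2 * r)))
    (hβ : β.transpose = β.map (conjFq p r)) (hβ' : IsUnit β.det) :
    ((¬ l ∣ n ∨ ¬ l ∣ p ^ r + 1) →
      essentialDimensionAt k (PSU p r n β) l = essentialDimensionAt k (SU p r n β) l) ∧
    ((l ∣ n ∧ l ∣ p ^ r + 1) →
      essentialDimensionAt k (PSU p r n β) l =
        essentialDimensionAt k
          (Matrix.ProjectiveSpecialLinearGroup (Fin n) (GaloisField p (2 * r))) l ∧
      ∀ (P : Sylow l (PSU p r n β))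
        (Q : Sylow l (Matrix.ProjectiveSpecialLinearGroup (Fin n) (GaloisField p (2 * r)))),
        Nonempty (P ≃* Q)) := by
  have hK : Nat.card (GaloisField p (2 * r)) = (p ^ r) ^ 2 := by
    rw [GaloisField.card p (2 * r) (by omega), ← pow_mul, mul_comm]
  have : Finite (GaloisField p (2 * r)) :=
    Nat.finite_of_card_ne_zero (hK ▸ pow_ne_zero _ (pow_ne_zero _ (Fact.out : p.Prime).ne_zero))
  have h := theorem11p1_general hK (conjFq_apply p r) hβ hβ' hl k
  exact ⟨h.1, fun hlnq => h.2 ⟨hl2, hlnq.2⟩⟩
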